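/- Let $\mathbb{K}$ be a field of characteristic zero, let $V$ be a $3$-dimensional $\mathbb{K}$-vector space, let $\mathscr{A}$ be a finite set of $n$ hyperplanes of $V$ through the origin that is essential, i.e. $\bigcap_{H\in\mathscr{A}}H=\{0\}$, and let $m\ge 0$ be an integer with $m\geq n-2$. Let $S=\mathrm{Sym}(V^*)=\mathbb{K}[x_1,x_2,x_3]$ for a basis $x_1,x_2,x_3$ of $V^*$, let $\partial_i=\partial/\partial x_i$, and let $Q=\prod_{H\in\mathscr{A}}\alpha_H$, where $\alpha_H\in V^*$ has zero set $H$. Put $D^{(m)}(S)=\sum_{|a|=m}S\,\partial^{a}$ and $D^{(m)}(\mathscr{A},V)=\{\theta\in D^{(m)}(S)\mid \theta(QS)\subseteq QS\}$. The arrangement is called $m$-free if the $S$-module $D^{(m)}(\mathscr{A},V)$ has a free basis $\theta_1,\dots,\theta_s$ with $s=\binom{m+2}{m}$. An operator $\theta=\sum_{|a|=m}f_a\partial^a$ is called homogeneous of degree $d$ if every $f_a$ is homogeneous of degree $d$. The multiset $\exp_m(\mathscr{A},V)=\{\deg\theta_1,\dots,\deg\theta_s\}$ of degrees of a free basis consisting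 of homogeneous operators is called the multiset of $m$-exponents. Let $L(\mathscr{A})=\{\bigcap_{H\in\mathscr{B}}H\mid\mathscr{B}\subseteq\mathscr{A}\}$ be the intersection lattice (with $V$ as the intersection of the empty family), let $L(\mathscr{A})_1$ be the set of its one-dimensional elements, and let $\mathscr{A}_X=\{H\in\mathscr{A}\mid X\subseteq H\}$. Then $(\mathscr{A},V)$ is $m$-free, a free basis consisting of homogeneous operators exists, and the multiset of degrees of every such basis is $$\exp_m(\mathscr{A},V)=\{j+n-|\mathscr{A}_X| \mid X\in L(\mathscr{A})_1,\ 0\le j\le |\mathscr{A}_X|-2\}\ \cup\ \Big\{(n-1)^{(m+2)n-n^2+\binom n2-\sum_{X\in L(\mathscr{A})_1}(|\mathscr{A}_X|-1)},\ n^{\binom{m+2-n}{2}}\Big\},$$ where $e^i$ means that $e$ is listed $i$ times and the union is the sum of multisets (multiplicities add up; the first multiset has one entry for each pair $(X,j)$). In particular the $m$-exponents are determined by the intersection lattice: if $(\mathscr{A}',V')$ is another essential arrangement in a $3$-dimensional vector space over a field of characteristic zero and $L(\mathscr{A}')$ and $L(\mathscr{A})$ are isomorphic as partially ordered sets, then $\exp_m(\mathscr{A}',V')=\exp_m(\mathscr{A},V)$.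 -/

import Mathlib

/-- A central hyperplane arrangement in a vector space `V` over a field `K`: a finite set of
linear subspaces of codimension one. -/
structure CentralArrangement (K V : Type*) [Field K] [AddCommGroup V] [Module K V] where
  hyperplanes : Finset (Submodule K V)
  codim_one : ∀ H ∈ hyperplanes, Module.finrank K (V ⧸ H) = 1

namespace CentralArrangement

/-- The number `n = |A|` of hyperplanes. -/
def card {K V : Type*} [Field K] [AddCommGroup V] [Module K V]
    (A : CentralArrangement K V) : ℕ :=
  A.hyperplanes.card

/-- The arrangement is essential if its hyperplanes meet only in the origin. -/
def IsEssential {K V : Type*} [Field K] [AddCommGroup V] [Module K V]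
    (A : CentralArrangement K V) : Prop :=
  A.hyperplanes.inf id = ⊥

open Classical in
/-- The intersection lattice `L(A)`, the (finite) set of all intersections of subsets of `A`;
the intersection of the empty subset is `V`. -/
noncomputable def lattice {K V : Type*} [Field K] [AddCommGroup V] [Module K V]
    (A : CentralArrangement K V) : Finset (Submodule K V) :=
  A.hyperplanes.powerset.image fun B => B.inf id

open Classical in
/-- The set `L(A)_1` of one-dimensional elements of the intersection lattice. -/
noncomputable def lattice₁ {K V : Type*} [Field K] [AddCommGroup V] [Module K V]
    (A : CentralArrangement K V) : Finset (Submodule K V) :=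
  A.lattice.filter fun X => Module.finrank K X = 1

open Classical in
/-- The localization `A_X`, the hyperplanes of `A` that contain `X`. -/
noncomputable def localization {K V : Type*} [Field K] [AddCommGroup V] [Module K V]
    (A : CentralArrangement K V) (X : Submodule K V) : CentralArrangement K V where
  hyperplanes := A.hyperplanes.filter fun H => X ≤ H
  codim_one H hH := A.codim_one H (Finset.mem_filter.mp hH).1

theorem exists_ker_eq {K V : Type*} [Field K] [AddCommGroup V] [Module K V]
    (A : CentralArrangement K V) (H : A.hyperplanes) :
    ∃ α : Module.Dual K V, LinearMap.ker α = H.1 := by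
  obtain ⟨e⟩ := Module.nonempty_linearEquiv_of_finrank_eq_one (A.codim_one H.1 H.2)
  refine ⟨e.symm.toLinearMap ∘ₗ H.1.mkQ, ?_⟩
  rw [LinearEquiv.ker_comp, Submodule.ker_mkQ]

/-- A linear form `α_H` whose zero set is the hyperplane `H`; it is unique up to a nonzero
scalar. -/
noncomputable def linearForm {K V : Type*} [Field K] [AddCommGroup V] [Module K V]
    (A : CentralArrangement K V) (H : A.hyperplanes) : Module.Dual K V :=
  (A.exists_ker_eq H).choose

/-- The degree one polynomial, in the coordinates `x`, of a linear form on `V`. -/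
noncomputable def toPolynomial {K V : Type*} [Field K] [AddCommGroup V] [Module K V] {l : ℕ}
    (x : Module.Basis (Fin l) K (Module.Dual K V)) (α : Module.Dual K V) :
    MvPolynomial (Fin l) K :=
  ∑ i, MvPolynomial.C (x.repr α i) * MvPolynomial.X i

/-- The defining polynomial `Q = ∏ α_H`, in the coordinates `x`. -/
noncomputable def definingPolynomial {K V : Type*} [Field K] [AddCommGroup V] [Module K V]
    {l : ℕ} (A : CentralArrangement K V) (x : Module.Basis (Fin l) K (Module.Dual K V)) :
    MvPolynomial (Fin l) K :=
  ∏ H : A.hyperplanes, toPolynomial x (A.linearForm H)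

/-- The operator `∂^a = ∂₁^{a₁} ⋯ ∂ₗ^{aₗ}` on the polynomial ring. -/
noncomputable def partialPow (K : Type*) [Field K] {l : ℕ} (a : Fin l → ℕ) :
    Module.End K (MvPolynomial (Fin l) K) :=
  (List.ofFn fun i =>
    ((MvPolynomial.pderiv (R := K) i).toLinearMap : Module.End K (MvPolynomial (Fin l) K))
      ^ a i).prod

/-- The `S`-module `D^(m)(S) = ∑_{|a| = m} S ∂^a` of operators on `S = K[x₁, …, xₗ]`, where `S`
acts on operators by multiplication from the left. -/
noncomputable def diffOps (K : Type*) [Field K] (l m : ℕ) :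
    Submodule (MvPolynomial (Fin l) K) (Module.End K (MvPolynomial (Fin l) K)) :=
  Submodule.span (MvPolynomial (Fin l) K)
    {D | ∃ a : Fin l → ℕ, ∑ i, a i = m ∧ D = partialPow K a}

/-- `deg θ = d`: the operator is `θ = ∑_{|a| = m} f_a ∂^a` with every `f_a` homogeneous of
degree `d` (the zero polynomial is homogeneous of every degree). -/
def HasDegree {K : Type*} [Field K] {l : ℕ} (m : ℕ)
    (θ : Module.End K (MvPolynomial (Fin l) K)) (d : ℕ) : Prop :=
  ∃ f : (Fin l → ℕ) → MvPolynomial (Fin l) K,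
    (∀ a, (f a).IsHomogeneous d) ∧
      θ = ∑ a ∈ Finset.piAntidiag (Finset.univ : Finset (Fin l)) m, f a • partialPow K a

/-- The `S`-module `D^(m)(A, V)` of `m`-th order `A`-differential operators: the
`θ ∈ D^(m)(S)` with `θ(QS) ⊆ QS`. -/
noncomputable def diffModule {K V : Type*} [Field K] [AddCommGroup V] [Module K V] {l : ℕ}
    (A : CentralArrangement K V) (x : Module.Basis (Fin l) K (Module.Dual K V)) (m : ℕ) :
    Submodule (MvPolynomial (Fin l) K) (Module.End K (MvPolynomial (Fin l) K)) where
  carrier := {θ | θ ∈ diffOps K l m ∧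
    ∀ f, A.definingPolynomial x ∣ θ (A.definingPolynomial x * f)}
  add_mem' ha hb := ⟨add_mem ha.1 hb.1, fun f => dvd_add (ha.2 f) (hb.2 f)⟩
  zero_mem' := ⟨zero_mem _, fun _ => dvd_zero _⟩
  smul_mem' c _ h := ⟨Submodule.smul_mem _ c h.1, fun f => (h.2 f).mul_left c⟩

/-- A free basis of `D^(m)(A, V)`: a family of `s_m(l) = binom(m + l - 1, m)` operators that is
linearly independent over `S` and generates `D^(m)(A, V)` over `S`. -/
def IsFreeBasis {K V : Type*} [Field K] [AddCommGroup V] [Module K V] {l : ℕ}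
    (A : CentralArrangement K V) (x : Module.Basis (Fin l) K (Module.Dual K V)) (m : ℕ)
    (θ : Fin ((m + l - 1).choose m) → Module.End K (MvPolynomial (Fin l) K)) : Prop :=
  LinearIndependent (MvPolynomial (Fin l) K) θ ∧
    Submodule.span (MvPolynomial (Fin l) K) (Set.range θ) = A.diffModule x m

/-- The arrangement is `m`-free. -/
def IsMFree {K V : Type*} [Field K] [AddCommGroup V] [Module K V] {l : ℕ}
    (A : CentralArrangement K V) (x : Module.Basis (Fin l) K (Module.Dual K V)) (m : ℕ) : Prop :=
  ∃ θ, A.IsFreeBasis x m θ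

/-- `E` is a multiset of `m`-exponents of the arrangement: the multiset of degrees
`deg θ₁, …, deg θ_s` of a free basis of `D^(m)(A, V)` that consists of homogeneous operators. -/
def IsExponents {K V : Type*} [Field K] [AddCommGroup V] [Module K V] {l : ℕ}
    (A : CentralArrangement K V) (x : Module.Basis (Fin l) K (Module.Dual K V)) (m : ℕ)
    (E : Multiset ℕ) : Prop :=
  ∃ (θ : Fin ((m + l - 1).choose m) → Module.End K (MvPolynomial (Fin l) K))
    (d : Fin ((m + l - 1).choose m) → ℕ),
    A.IsFreeBasis x m θ ∧ (∀ i, HasDegree m (θ i) (d i)) ∧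
      E = (Finset.univ : Finset (Fin ((m + l - 1).choose m))).val.map d

end CentralArrangement

namespace CentralArrangement
open MvPolynomial

theorem degree_eq_of_mem_support {σ R : Type*} [CommSemiring R] {m : ℕ} {g : MvPolynomial σ R}
    (hg : g.IsHomogeneous m) {b : σ →₀ ℕ} (hb : b ∈ g.support) : b.degree = m := by
  rw [hg.degree_eq_sum_deg_support hb, Finsupp.degree_apply]

theorem homogeneousSubmodule_hom_ext {R : Type*} [CommSemiring R] {l : ℕ} {M : Type*}
    [AddCommMonoid M] [Module R M] {m : ℕ} (φ : homogeneousSubmodule (Fin l) R m →ₗ[R] M)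
    (ψ : homogeneousSubmodule (Fin l) R m →ₗ[R] M)
    (h : ∀ (b : Fin l →₀ ℕ) (hb : b.degree = m),
      φ ⟨monomial b 1, isHomogeneous_monomial 1 hb⟩ =
        ψ ⟨monomial b 1, isHomogeneous_monomial 1 hb⟩) :
    φ = ψ := by
  ext ⟨g, hg⟩
  have hsum : (⟨g, hg⟩ : homogeneousSubmodule (Fin l) R m) = ∑ b ∈ g.support.attach,
      coeff b.1 g • ⟨monomial b.1 1, isHomogeneous_monomial 1
        (degree_eq_of_mem_support hg b.2)⟩ := by
    apply Subtype.ext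
    simp only [Submodule.coe_sum, Submodule.coe_smul, smul_monomial, smul_eq_mul, mul_one]
    rw [Finset.sum_attach g.support (fun b => monomial b (coeff b g))]
    exact (support_sum_monomial_coeff g).symm
  rw [hsum, map_sum, map_sum]
  refine Finset.sum_congr rfl fun b _ => ?_
  rw [map_smul, map_smul, h _ (degree_eq_of_mem_support hg b.2)]

section

variable {K : Type*} [Field K] {l : ℕ}

theorem list_prod_pderiv_monomial (a : Fin l → ℕ) (L : List (Fin l)) (hL : L.Nodup)
    (b : Fin l →₀ ℕ) (c : K) :
    (L.map fun i => ((pderiv (R := K) i).toLinearMap : Module.End K (MvPolynomial (Fin l) K))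
      ^ a i).prod (monomial b c) =
    monomial (b - (L.map fun i => Finsupp.single i (a i)).sum)
      (c * (L.map fun i => ((b i).descFactorial (a i) : K)).prod) := by
  have hpow : ∀ (i : Fin l) (k : ℕ) (b : Fin l →₀ ℕ) (c : K),
      (((pderiv (R := K) i).toLinearMap : Module.End K (MvPolynomial (Fin l) K)) ^ k)
        (monomial b c) =
      monomial (b - Finsupp.single i k) (c * ((b i).descFactorial k : K)) := by
    intro i k
    induction k with
    | zero => simp
    | succ k ih =>
      intro b c
      rw [pow_succ', Module.End.mul_apply, ih]
      simp only [Derivation.coeFn_coe, pderiv_monomial, Nat.descFactorial_succ]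
      congr 1
      · congr 1
        ext j
        by_cases hj : j = i <;> simp [hj, Nat.sub_sub]
      · simp only [Finsupp.coe_tsub, Pi.sub_apply, Finsupp.single_eq_same]
        push_cast
        ring
  induction L with
  | nil => simp
  | cons i L ih =>
    rw [List.nodup_cons] at hL
    rw [List.map_cons, List.prod_cons, Module.End.mul_apply, ih hL.2, hpow]
    have hz : ((L.map fun j => Finsupp.single j (a j)).sum : Fin l →₀ ℕ) i = 0 := by
      have := hL.1
      clear ih hL
      induction L with
      | nil => simp
      | cons j L ih =>
        simp only [List.mem_cons, not_or] at this
        simp [ih this.2, Ne.symm this.1]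
    congr 1
    · rw [List.map_cons, List.sum_cons, add_comm, tsub_add_eq_tsub_tsub]
    · simp only [Finsupp.coe_tsub, Pi.sub_apply, hz, tsub_zero, List.map_cons, List.prod_cons]
      ring

theorem partialPow_monomial (a : Fin l → ℕ) (b : Fin l →₀ ℕ) (c : K) :
    partialPow K a (monomial b c) =
      monomial (b - Finsupp.equivFunOnFinite.symm a)
        (c * ∏ i, ((b i).descFactorial (a i) : K)) := by
  rw [partialPow, List.ofFn_eq_map, list_prod_pderiv_monomial _ _ (List.nodup_finRange l),
    ← List.ofFn_eq_map, ← List.ofFn_eq_map, List.prod_ofFn, List.sum_ofFn]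
  congr 2
  ext j
  simp [Finsupp.single_apply]

theorem partialPow_monomial_self (b : Fin l →₀ ℕ) :
    partialPow K b (monomial b 1) = C (∏ i, ((b i).factorial : K)) := by
  rw [partialPow_monomial]
  have : b - Finsupp.equivFunOnFinite.symm ⇑b = 0 := by ext; simp
  rw [this]
  simp [Nat.descFactorial_self]

theorem partialPow_monomial_eq_zero (a : Fin l → ℕ) (b : Fin l →₀ ℕ) (c : K)
    (h : b.degree ≤ ∑ i, a i) (hne : ⇑b ≠ a) : partialPow K a (monomial b c) = 0 := by
  have : ∃ i, b i < a i := by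
    by_contra! hcon
    apply hne
    rw [Finsupp.degree_eq_sum] at h
    have := (Finset.sum_eq_sum_iff_of_le (s := Finset.univ) (fun i _ => hcon i)).1
      (le_antisymm (Finset.sum_le_sum fun i _ => hcon i) h)
    exact funext fun i => (this i (Finset.mem_univ i)).symm
  obtain ⟨i, hi⟩ := this
  rw [partialPow_monomial, Finset.prod_eq_zero (Finset.mem_univ i)]
  · simp
  · rw [Nat.descFactorial_of_lt hi, Nat.cast_zero]

theorem pderiv_partialPow (i : Fin l) (a : Fin l → ℕ) (f : MvPolynomial (Fin l) K) :
    pderiv i (partialPow K a f) = partialPow K (a + Pi.single i 1) f := by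
  induction f using MvPolynomial.induction_on' with
  | add p q hp hq => simp [hp, hq]
  | monomial b c =>
    rw [partialPow_monomial, partialPow_monomial, pderiv_monomial]
    congr 1
    · congr 1
      ext j
      by_cases hj : j = i
      · subst hj; simp [Nat.sub_sub]
      · simp [hj]
    · rw [mul_assoc]
      congr 1
      have h1 := Finset.mul_prod_erase Finset.univ
        (fun j => ((b j).descFactorial (a j) : K)) (Finset.mem_univ i)
      have h2 := Finset.mul_prod_erase Finset.univ
        (fun j => ((b j).descFactorial ((a + Pi.single i 1 : Fin l → ℕ) j) : K)) (Finset.mem_univ i)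
      rw [← h1, ← h2]
      have h3 : ∏ j ∈ Finset.univ.erase i, ((b j).descFactorial ((a + Pi.single i 1 : Fin l → ℕ) j) : K) =
          ∏ j ∈ Finset.univ.erase i, ((b j).descFactorial (a j) : K) := by
        refine Finset.prod_congr rfl fun j hj => ?_
        simp [Finset.ne_of_mem_erase hj]
      rw [h3]
      simp only [Pi.add_apply, Pi.single_eq_same, Nat.descFactorial_succ]
      simp only [Finsupp.coe_tsub, Pi.sub_apply, Finsupp.equivFunOnFinite_symm_apply_apply]
      push_cast
      ring

theorem partialPow_zero : partialPow K (0 : Fin l → ℕ) = 1 := by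
  simp [partialPow, List.ofFn_const]

/-- The commutator of an operator with the multiplication by a polynomial. -/
noncomputable def commMul (y : MvPolynomial (Fin l) K)
    (θ : Module.End K (MvPolynomial (Fin l) K)) : Module.End K (MvPolynomial (Fin l) K) :=
  θ * LinearMap.mulLeft K y - LinearMap.mulLeft K y * θ

theorem commMul_apply (y : MvPolynomial (Fin l) K) (θ : Module.End K (MvPolynomial (Fin l) K))
    (f : MvPolynomial (Fin l) K) : commMul y θ f = θ (y * f) - y * θ f := rfl

theorem exists_eq_add_single {a : Fin l → ℕ} {k : ℕ} (ha : ∑ i, a i = k + 1) :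
    ∃ (i : Fin l) (b : Fin l → ℕ), ∑ i, b i = k ∧ a = b + Pi.single i 1 := by
  obtain ⟨i, hi⟩ : ∃ i, a i ≠ 0 := by
    by_contra! h
    simp [h] at ha
  have hab : a = a - Pi.single i 1 + Pi.single i 1 := by
    funext t
    by_cases ht : t = i
    · subst ht; simp; omega
    · simp [ht]
  refine ⟨i, a - Pi.single i 1, ?_, hab⟩
  rw [hab] at ha
  simpa [Finset.sum_add_distrib] using ha

theorem commMul_partialPow_mem (j : Fin l) (k : ℕ) (a : Fin l → ℕ) (ha : ∑ i, a i = k + 1) :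
    commMul (X j) (partialPow K a) ∈
      Submodule.span K {D | ∃ b : Fin l → ℕ, ∑ i, b i = k ∧ D = partialPow K b} := by
  induction k generalizing a with
  | zero =>
    obtain ⟨i, b, hb, rfl⟩ := exists_eq_add_single ha
    have hb : b = 0 := by
      funext t
      exact (Finset.sum_eq_zero_iff.1 hb) t (Finset.mem_univ t)
    subst hb
    have : commMul (X j) (partialPow K (0 + Pi.single i 1)) =
        ((Pi.single j 1 : Fin l → K) i) • partialPow K (0 : Fin l → ℕ) := by
      apply LinearMap.ext
      intro f
      rw [commMul_apply, ← pderiv_partialPow, ← pderiv_partialPow, partialPow_zero]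
      simp only [Module.End.one_apply, pderiv_mul, pderiv_X, LinearMap.smul_apply]
      by_cases h : j = i
      · subst h; simp
      · simp [h, Ne.symm h]
    rw [this]
    exact Submodule.smul_mem _ _ (Submodule.subset_span ⟨0, by simp, rfl⟩)
  | succ k ih =>
    obtain ⟨i, b, hb, rfl⟩ := exists_eq_add_single ha
    have : commMul (X j) (partialPow K (b + Pi.single i 1)) =
        (pderiv (R := K) i).toLinearMap * commMul (X j) (partialPow K b) +
        ((Pi.single j 1 : Fin l → K) i) • partialPow K b := by
      apply LinearMap.ext
      intro f
      rw [commMul_apply, ← pderiv_partialPow, ← pderiv_partialPow]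
      simp only [LinearMap.add_apply, Module.End.mul_apply, commMul_apply, LinearMap.smul_apply,
        Derivation.coeFn_coe, map_sub, pderiv_mul, pderiv_X]
      by_cases h : j = i
      · subst h
        simp only [Pi.single_eq_same, one_mul, one_smul]
        ring
      · simp [h, Ne.symm h]
    rw [this]
    refine add_mem ?_ (Submodule.smul_mem _ _ (Submodule.subset_span ⟨b, hb, rfl⟩))
    have h1 := Submodule.mem_map_of_mem
      (f := LinearMap.mulLeft K ((pderiv (R := K) i).toLinearMap :
        Module.End K (MvPolynomial (Fin l) K))) (ih b hb)
    rw [Submodule.map_span] at h1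
    refine Submodule.span_mono ?_ h1
    rintro _ ⟨_, ⟨c, hc, rfl⟩, rfl⟩
    refine ⟨c + Pi.single i 1, ?_, ?_⟩
    · simp [Finset.sum_add_distrib, hc]
    · apply LinearMap.ext
      intro f
      simp [← pderiv_partialPow]

theorem commMul_X_mem_diffOps (j : Fin l) {k : ℕ} {θ : Module.End K (MvPolynomial (Fin l) K)}
    (hθ : θ ∈ diffOps K l (k + 1)) : commMul (X j) θ ∈ diffOps K l k := by
  induction hθ using Submodule.span_induction with
  | mem θ h =>
    obtain ⟨a, ha, rfl⟩ := h
    exact Submodule.span_le_restrictScalars K (MvPolynomial (Fin l) K) _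
      (commMul_partialPow_mem j k a ha)
  | zero =>
    have : commMul (X j) (0 : Module.End K (MvPolynomial (Fin l) K)) = 0 := by
      refine LinearMap.ext fun f => ?_
      simp [commMul_apply]
    rw [this]; exact zero_mem _
  | add θ η _ _ h1 h2 =>
    have : commMul (X j) (θ + η) = commMul (X j) θ + commMul (X j) η := by
      refine LinearMap.ext fun f => ?_
      simp only [commMul_apply, LinearMap.add_apply]
      ring
    rw [this]; exact add_mem h1 h2
  | smul c θ _ h =>
    have : commMul (X j) (c • θ) = c • commMul (X j) θ := by
      refine LinearMap.ext fun f => ?_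
      simp only [commMul_apply, LinearMap.smul_apply, smul_eq_mul]
      ring
    rw [this]; exact Submodule.smul_mem _ _ h

theorem commMul_mem_diffOps {k : ℕ} {θ : Module.End K (MvPolynomial (Fin l) K)}
    (hθ : θ ∈ diffOps K l (k + 1)) (c : Fin l → K) :
    commMul (∑ i, C (c i) * X i) θ ∈ diffOps K l k := by
  have : commMul (∑ i, C (c i) * X i) θ =
      ∑ i, (C (c i) : MvPolynomial (Fin l) K) • commMul (X i) θ := by
    refine LinearMap.ext fun f => ?_
    simp only [commMul_apply, LinearMap.sum_apply, LinearMap.smul_apply, smul_eq_mul,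
      Finset.sum_mul, map_sum, mul_sub, Finset.sum_sub_distrib, mul_assoc]
    congr 1
    refine Finset.sum_congr rfl fun i _ => ?_
    rw [← smul_eq_C_mul, map_smul, smul_eq_C_mul]
  rw [this]
  exact sum_mem fun i _ => Submodule.smul_mem _ _ (commMul_X_mem_diffOps i hθ)

theorem diffOps_apply_monomial_eq_zero {m : ℕ} {θ : Module.End K (MvPolynomial (Fin l) K)}
    (hθ : θ ∈ diffOps K l m) (b : Fin l →₀ ℕ) (c : K) (hb : b.degree < m) :
    θ (monomial b c) = 0 := by
  induction hθ using Submodule.span_induction with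
  | mem θ h =>
    obtain ⟨a, ha, rfl⟩ := h
    refine partialPow_monomial_eq_zero a b c (by omega) ?_
    rintro rfl
    rw [Finsupp.degree_eq_sum] at hb
    omega
  | zero => simp
  | add θ η _ _ h1 h2 => simp [h1, h2]
  | smul c θ _ h => simp [h]

theorem degree_equivFunOnFinite_symm (a : Fin l → ℕ) :
    (Finsupp.equivFunOnFinite.symm a).degree = ∑ i, a i := by
  rw [Finsupp.degree_eq_sum]; rfl

theorem prod_factorial_ne_zero [CharZero K] (a : Fin l → ℕ) : (∏ i, ((a i).factorial : K)) ≠ 0 :=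
  Finset.prod_ne_zero_iff.2 fun _ _ => Nat.cast_ne_zero.2 (Nat.factorial_ne_zero _)

theorem eq_sum_partialPow [CharZero K] {m : ℕ} {θ : Module.End K (MvPolynomial (Fin l) K)}
    (hθ : θ ∈ diffOps K l m) :
    θ = ∑ a ∈ Finset.piAntidiag (Finset.univ : Finset (Fin l)) m,
      (C (∏ i, ((a i).factorial : K))⁻¹ * θ (monomial (Finsupp.equivFunOnFinite.symm a) 1)) •
        partialPow K a := by
  induction hθ using Submodule.span_induction with
  | mem θ h =>
    obtain ⟨a, ha, rfl⟩ := h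
    rw [Finset.sum_eq_single a]
    · have := partialPow_monomial_self (K := K) (Finsupp.equivFunOnFinite.symm a)
      simp only [Finsupp.coe_equivFunOnFinite_symm] at this
      rw [this, ← C_mul, inv_mul_cancel₀ (prod_factorial_ne_zero a), C_1, one_smul]
    · intro b hb hne
      rw [partialPow_monomial_eq_zero, mul_zero, zero_smul]
      · rw [degree_equivFunOnFinite_symm, ha]
        exact (Finset.mem_piAntidiag.1 hb).1.le
      · simpa using hne
    · intro h
      simp [ha] at h
  | zero => simp
  | add θ η _ _ h1 h2 =>
    conv_lhs => rw [h1, h2]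
    rw [← Finset.sum_add_distrib]
    refine Finset.sum_congr rfl fun a _ => ?_
    rw [LinearMap.add_apply, mul_add, add_smul]
  | smul c θ _ h =>
    conv_lhs => rw [h]
    rw [Finset.smul_sum]
    refine Finset.sum_congr rfl fun a _ => ?_
    rw [LinearMap.smul_apply, smul_smul, smul_eq_mul]
    congr 1
    ring

theorem sum_partialPow_apply_monomial {m : ℕ} (f : (Fin l → ℕ) → MvPolynomial (Fin l) K)
    (b : Fin l →₀ ℕ) (hb : b.degree = m) :
    (∑ a ∈ Finset.piAntidiag (Finset.univ : Finset (Fin l)) m, f a • partialPow K a)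
      (monomial b 1) = f b * C (∏ i, ((b i).factorial : K)) := by
  rw [LinearMap.sum_apply, Finset.sum_eq_single ⇑b]
  · rw [LinearMap.smul_apply, partialPow_monomial_self, smul_eq_mul]
  · intro a ha hne
    rw [LinearMap.smul_apply, partialPow_monomial_eq_zero, smul_zero]
    · rw [hb, (Finset.mem_piAntidiag.1 ha).1]
    · exact hne.symm
  · intro h
    rw [Finsupp.degree_eq_sum] at hb
    simp [hb] at h

theorem sum_partialPow_mem_diffOps {m : ℕ} (f : (Fin l → ℕ) → MvPolynomial (Fin l) K) :
    ∑ a ∈ Finset.piAntidiag (Finset.univ : Finset (Fin l)) m, f a • partialPow K a ∈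
      diffOps K l m :=
  sum_mem fun a ha => Submodule.smul_mem _ _
    (Submodule.subset_span ⟨a, (Finset.mem_piAntidiag.1 ha).1, rfl⟩)

theorem HasDegree.mem_diffOps {m d : ℕ} {θ : Module.End K (MvPolynomial (Fin l) K)}
    (h : HasDegree m θ d) : θ ∈ diffOps K l m := by
  obtain ⟨f, -, rfl⟩ := h
  exact sum_partialPow_mem_diffOps f

/-- The restriction of an operator to the homogeneous polynomials of degree `m`. -/
noncomputable def restrictHom (K : Type*) [Field K] (l m : ℕ) :
    Module.End K (MvPolynomial (Fin l) K) →ₗ[MvPolynomial (Fin l) K]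
      (homogeneousSubmodule (Fin l) K m →ₗ[K] MvPolynomial (Fin l) K) where
  toFun θ := θ ∘ₗ (homogeneousSubmodule (Fin l) K m).subtype
  map_add' _ _ := rfl
  map_smul' _ _ := rfl

theorem restrictHom_apply {m : ℕ} (θ : Module.End K (MvPolynomial (Fin l) K))
    (g : homogeneousSubmodule (Fin l) K m) : restrictHom K l m θ g = θ g := rfl

theorem restrictHom_injOn [CharZero K] {m : ℕ} {θ η : Module.End K (MvPolynomial (Fin l) K)}
    (hθ : θ ∈ diffOps K l m) (hη : η ∈ diffOps K l m)
    (h : restrictHom K l m θ = restrictHom K l m η) : θ = η := by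
  rw [eq_sum_partialPow hθ, eq_sum_partialPow hη]
  refine Finset.sum_congr rfl fun a ha => ?_
  have ha' : (Finsupp.equivFunOnFinite.symm a).degree = m := by
    rw [degree_equivFunOnFinite_symm]; exact (Finset.mem_piAntidiag.1 ha).1
  have := LinearMap.congr_fun h
    ⟨monomial (Finsupp.equivFunOnFinite.symm a) 1, isHomogeneous_monomial 1 ha'⟩
  rw [restrictHom_apply, restrictHom_apply] at this
  rw [this]

open Classical in
theorem exists_restrictHom_eq [CharZero K] {m : ℕ}
    (φ : homogeneousSubmodule (Fin l) K m →ₗ[K] MvPolynomial (Fin l) K) :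
    ∃ f : (Fin l → ℕ) → MvPolynomial (Fin l) K,
      (∀ d, (∀ g, (φ g).IsHomogeneous d) → ∀ a, (f a).IsHomogeneous d) ∧
      restrictHom K l m (∑ a ∈ Finset.piAntidiag (Finset.univ : Finset (Fin l)) m,
        f a • partialPow K a) = φ := by
  refine ⟨fun a => if h : (Finsupp.equivFunOnFinite.symm a).degree = m then
    C (∏ i, ((a i).factorial : K))⁻¹ *
      φ ⟨monomial (Finsupp.equivFunOnFinite.symm a) 1, isHomogeneous_monomial 1 h⟩ else 0, ?_, ?_⟩
  · intro d hd a
    dsimp only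
    split_ifs
    · exact (hd _).C_mul _
    · exact isHomogeneous_zero _ _ _
  · refine homogeneousSubmodule_hom_ext _ _ fun b hb => ?_
    rw [restrictHom_apply, sum_partialPow_apply_monomial _ _ hb]
    have : (Finsupp.equivFunOnFinite.symm ⇑b) = b := by ext; simp
    simp only [this, hb, dif_pos]
    rw [mul_right_comm, ← C_mul, inv_mul_cancel₀ (prod_factorial_ne_zero ⇑b), C_1, one_mul]

theorem HasDegree.isHomogeneous_apply {m d : ℕ} {θ : Module.End K (MvPolynomial (Fin l) K)}
    (h : HasDegree m θ d) {g : MvPolynomial (Fin l) K} (hg : g.IsHomogeneous m) :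
    (θ g).IsHomogeneous d := by
  obtain ⟨f, hf, rfl⟩ := h
  rw [← support_sum_monomial_coeff g, map_sum]
  refine IsHomogeneous.sum _ _ _ fun b hb => ?_
  have h1 : monomial b (coeff b g) = coeff b g • monomial b (1 : K) := by simp [smul_monomial]
  rw [h1, map_smul, sum_partialPow_apply_monomial _ _ (degree_eq_of_mem_support hg hb),
    smul_eq_C_mul, mul_comm (f _)]
  exact ((hf _).C_mul _).C_mul _

end

section Homogeneous

variable {σ R : Type*} [CommSemiring R]

theorem homogeneousComponent_mul_of_isHomogeneous {d : ℕ} (e : ℕ) (h : MvPolynomial σ R)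
    {q : MvPolynomial σ R} (hq : q.IsHomogeneous d) :
    homogeneousComponent e (h * q) =
      if d ≤ e then homogeneousComponent (e - d) h * q else 0 := by
  conv_lhs => rw [← sum_homogeneousComponent h, Finset.sum_mul, map_sum]
  have key : ∀ i, homogeneousComponent e (homogeneousComponent i h * q) =
      if e = i + d then homogeneousComponent i h * q else 0 := fun i =>
    homogeneousComponent_of_mem ((homogeneousComponent_isHomogeneous i h).mul hq)
  simp only [key]
  split_ifs with hde
  · rw [Finset.sum_eq_single (e - d)]
    · rw [if_pos (by omega)]
    · intro i _ hi
      rw [if_neg (by omega)]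
    · intro hi
      rw [if_pos (by omega), homogeneousComponent_eq_zero _ _ (by rw [Finset.mem_range] at hi; omega), zero_mul]
  · exact Finset.sum_eq_zero fun i _ => if_neg (by omega)

theorem exists_isHomogeneous_of_dvd {d e : ℕ} {q u : MvPolynomial σ R} (hq : q.IsHomogeneous d)
    (hu : u.IsHomogeneous (d + e)) (h : q ∣ u) :
    ∃ g : MvPolynomial σ R, g.IsHomogeneous e ∧ u = q * g := by
  obtain ⟨g, rfl⟩ := h
  refine ⟨homogeneousComponent e g, homogeneousComponent_isHomogeneous e g, ?_⟩
  conv_lhs => rw [← homogeneousComponent_eq_self hu, mul_comm,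
    homogeneousComponent_mul_of_isHomogeneous _ _ hq]
  rw [if_pos (by omega), Nat.add_sub_cancel_left, mul_comm]

end Homogeneous

section LinearForm

variable {K V : Type*} [Field K] [AddCommGroup V] [Module K V] {l : ℕ}
  (x : Module.Basis (Fin l) K (Module.Dual K V))

theorem toPolynomial_isHomogeneous (α : Module.Dual K V) : (toPolynomial x α).IsHomogeneous 1 :=
  IsHomogeneous.sum _ _ _ fun _ _ => isHomogeneous_C_mul_X _ _

theorem coeff_toPolynomial (α : Module.Dual K V) (i : Fin l) :
    coeff (Finsupp.single i 1) (toPolynomial x α) = x.repr α i := by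
  classical
  simp [toPolynomial, coeff_sum, coeff_C_mul, coeff_X, Finsupp.single_left_inj]

theorem toPolynomial_injective : Function.Injective (toPolynomial x) := by
  intro α β h
  apply x.repr.injective
  ext i
  rw [← coeff_toPolynomial, ← coeff_toPolynomial, h]

theorem toPolynomial_smul (c : K) (α : Module.Dual K V) :
    toPolynomial x (c • α) = C c * toPolynomial x α := by
  simp [toPolynomial, Finset.mul_sum, mul_assoc]

theorem toPolynomial_ne_zero {α : Module.Dual K V} (h : α ≠ 0) : toPolynomial x α ≠ 0 := by
  intro h0
  apply h
  apply toPolynomial_injective x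
  rw [h0]
  simp [toPolynomial]

theorem eval_toPolynomial (α : Module.Dual K V) (v : V) :
    eval (fun i => x i v) (toPolynomial x α) = α v := by
  conv_rhs => rw [← x.sum_repr α]
  simp [toPolynomial, LinearMap.sum_apply, -Module.Basis.sum_repr]

theorem prime_toPolynomial {α : Module.Dual K V} (h : α ≠ 0) : Prime (toPolynomial x α) := by
  apply Irreducible.prime
  have h0 := toPolynomial_ne_zero x h
  refine irreducible_of_totalDegree_eq_one
    ((toPolynomial_isHomogeneous x α).totalDegree h0) fun c hc => ?_
  rw [isUnit_iff_ne_zero]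
  rintro rfl
  exact h0 (MvPolynomial.ext _ _ fun b => by simpa using hc b)

theorem exists_smul_of_toPolynomial_dvd {α β : Module.Dual K V}
    (h : toPolynomial x α ∣ toPolynomial x β) : ∃ c : K, β = c • α := by
  obtain ⟨g, hg, h⟩ := exists_isHomogeneous_of_dvd (e := 0) (toPolynomial_isHomogeneous x α)
    (toPolynomial_isHomogeneous x β) h
  rw [← totalDegree_zero_iff_isHomogeneous, totalDegree_eq_zero_iff_eq_C] at hg
  refine ⟨coeff 0 g, toPolynomial_injective x ?_⟩
  rw [toPolynomial_smul, h, ← hg, mul_comm]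

variable (A : CentralArrangement K V)

theorem ker_linearForm (h : A.hyperplanes) : LinearMap.ker (A.linearForm h) = h.1 :=
  (A.exists_ker_eq h).choose_spec

theorem linearForm_ne_zero (h : A.hyperplanes) : A.linearForm h ≠ 0 := by
  intro h0
  have h1 := A.ker_linearForm h
  rw [h0, LinearMap.ker_zero] at h1
  have h2 := A.codim_one h.1 h.2
  rw [← h1] at h2
  have := Module.finrank_zero_of_subsingleton (R := K) (M := V ⧸ (⊤ : Submodule K V))
  omega

/-- The defining form of a hyperplane in the coordinates `x`. -/
noncomputable def form (h : A.hyperplanes) : MvPolynomial (Fin l) K :=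
  toPolynomial x (A.linearForm h)

theorem form_isHomogeneous (h : A.hyperplanes) : (A.form x h).IsHomogeneous 1 :=
  toPolynomial_isHomogeneous x _

theorem prime_form (h : A.hyperplanes) : Prime (A.form x h) :=
  prime_toPolynomial x (A.linearForm_ne_zero h)

theorem not_form_dvd_form {h h' : A.hyperplanes} (hne : h ≠ h') : ¬ A.form x h ∣ A.form x h' := by
  intro hd
  obtain ⟨c, hc⟩ := exists_smul_of_toPolynomial_dvd x hd
  apply hne
  apply Subtype.ext
  rw [← A.ker_linearForm h, ← A.ker_linearForm h', hc, LinearMap.ker_smul]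
  rintro rfl
  exact A.linearForm_ne_zero h' (by simpa using hc)

theorem definingPolynomial_eq : A.definingPolynomial x = ∏ h, A.form x h := rfl

theorem definingPolynomial_ne_zero : A.definingPolynomial x ≠ 0 :=
  Finset.prod_ne_zero_iff.2 fun h _ => (A.prime_form x h).ne_zero

theorem definingPolynomial_isHomogeneous : (A.definingPolynomial x).IsHomogeneous A.card := by
  have := IsHomogeneous.prod Finset.univ (fun h => A.form x h) (fun _ => 1)
    fun h _ => A.form_isHomogeneous x h
  rw [definingPolynomial_eq]
  convert this
  simp [card]

theorem isRelPrime_form {h h' : A.hyperplanes} (hne : h ≠ h') :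
    IsRelPrime (A.form x h) (A.form x h') :=
  (A.prime_form x h).irreducible.isRelPrime_iff_not_dvd.2 (A.not_form_dvd_form x hne)

theorem definingPolynomial_pow_dvd {f : MvPolynomial (Fin l) K} {t : ℕ}
    (hf : ∀ h, A.form x h ^ t ∣ f) : A.definingPolynomial x ^ t ∣ f := by
  rw [definingPolynomial_eq, ← Finset.prod_pow]
  exact Finset.prod_dvd_of_isRelPrime
    (fun h _ h' _ hne => (A.isRelPrime_form x hne).pow) fun h _ => hf h

theorem definingPolynomial_dvd {f : MvPolynomial (Fin l) K}
    (hf : ∀ h, A.form x h ∣ f) : A.definingPolynomial x ∣ f := by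
  simpa using A.definingPolynomial_pow_dvd x (t := 1) (f := f) (by simpa using hf)

open Classical in
/-- The product of the forms of all hyperplanes but one. -/
noncomputable def cofactor (h : A.hyperplanes) : MvPolynomial (Fin l) K :=
  ∏ h' ∈ Finset.univ.erase h, A.form x h'

theorem form_mul_cofactor (h : A.hyperplanes) :
    A.form x h * A.cofactor x h = A.definingPolynomial x :=
  Finset.mul_prod_erase Finset.univ (A.form x) (Finset.mem_univ h)

theorem form_dvd_cofactor {h h' : A.hyperplanes} (hne : h' ≠ h) :
    A.form x h' ∣ A.cofactor x h := by
  classical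
  exact Finset.dvd_prod_of_mem _ (Finset.mem_erase.2 ⟨hne, Finset.mem_univ h'⟩)

theorem not_form_dvd_cofactor (h : A.hyperplanes) : ¬ A.form x h ∣ A.cofactor x h := by
  classical
  rw [cofactor, (A.prime_form x h).dvd_finsetProd_iff]
  rintro ⟨h', hh', hd⟩
  exact A.not_form_dvd_form x (Finset.ne_of_mem_erase hh').symm hd

theorem cofactor_isHomogeneous (h : A.hyperplanes) :
    (A.cofactor x h).IsHomogeneous (A.card - 1) := by
  classical
  have := IsHomogeneous.prod (Finset.univ.erase h) (fun h => A.form x h) (fun _ => 1)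
    fun h _ => A.form_isHomogeneous x h
  simpa [card, cofactor] using this

end LinearForm

section DiffModule

variable {K : Type*} [Field K] {l : ℕ}

theorem apply_eq_of_mem_diffOps_zero {θ : Module.End K (MvPolynomial (Fin l) K)}
    (hθ : θ ∈ diffOps K l 0) (f : MvPolynomial (Fin l) K) : θ f = θ 1 * f := by
  induction hθ using Submodule.span_induction with
  | mem θ h =>
    obtain ⟨a, ha, rfl⟩ := h
    obtain rfl : a = 0 := funext fun i => (Finset.sum_eq_zero_iff.1 ha) i (Finset.mem_univ i)
    simp [partialPow_zero]
  | zero => simp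
  | add θ η _ _ h1 h2 => rw [LinearMap.add_apply, h1, h2, LinearMap.add_apply, add_mul]
  | smul c θ _ h => rw [LinearMap.smul_apply, h, LinearMap.smul_apply, smul_mul_assoc]

theorem dvd_apply_of_dvd_apply_mul {α P : MvPolynomial (Fin l) K} (hα : Prime α) (hP : ¬ α ∣ P)
    {k : ℕ} {θ : Module.End K (MvPolynomial (Fin l) K)} (hθ : θ ∈ diffOps K l k)
    (h : ∀ f, α ∣ θ (P * f)) (b : Fin l →₀ ℕ) (hb : b.degree = k) : α ∣ θ (monomial b 1) := by
  induction k generalizing θ b with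
  | zero =>
    obtain rfl : b = 0 := (Finsupp.degree_eq_zero_iff b).1 hb
    have h2 := h 1
    rw [mul_one, apply_eq_of_mem_diffOps_zero hθ] at h2
    exact (hα.dvd_or_dvd h2).resolve_right hP
  | succ k ih =>
    rw [Finsupp.degree_eq_sum] at hb
    obtain ⟨i, c, hc, hbc⟩ := exists_eq_add_single hb
    have hmon : monomial b (1 : K) = X i * monomial (Finsupp.equivFunOnFinite.symm c) 1 := by
      rw [X, monomial_mul, one_mul]
      refine congrArg (fun b => monomial b (1 : K)) (Finsupp.ext fun j => ?_)
      rw [hbc]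
      by_cases hj : j = i
      · subst hj; simp [add_comm]
      · simp [hj]
    have hc' := (degree_equivFunOnFinite_symm c).trans hc
    have h1 := ih (commMul_X_mem_diffOps i hθ) (fun f => by
      rw [commMul_apply, mul_left_comm]
      exact dvd_sub (h _) ((h f).mul_left _)) _ hc'
    rw [commMul_apply, diffOps_apply_monomial_eq_zero hθ _ _ (by omega), mul_zero, sub_zero,
      ← hmon] at h1
    exact h1

theorem dvd_apply_of_dvd_apply_isHomogeneous [CharZero K] {α : MvPolynomial (Fin l) K}
    {k : ℕ} {θ : Module.End K (MvPolynomial (Fin l) K)} (hθ : θ ∈ diffOps K l k)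
    (h : ∀ f : MvPolynomial (Fin l) K, f.IsHomogeneous k → α ∣ θ f)
    (f : MvPolynomial (Fin l) K) : α ∣ θ f := by
  rw [eq_sum_partialPow hθ, LinearMap.sum_apply]
  refine Finset.dvd_sum fun a ha => ?_
  rw [LinearMap.smul_apply, smul_eq_mul]
  refine ((h _ (isHomogeneous_monomial 1 ?_)).mul_left _).mul_right _
  rw [degree_equivFunOnFinite_symm, (Finset.mem_piAntidiag.1 ha).1]

variable {V : Type*} [AddCommGroup V] [Module K V] (A : CentralArrangement K V)
  (x : Module.Basis (Fin l) K (Module.Dual K V))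

/-- The `S`-module of `K`-linear maps from the homogeneous polynomials of degree `m` to `S` that
preserve divisibility by the form of every hyperplane. -/
noncomputable def logHom (m : ℕ) : Submodule (MvPolynomial (Fin l) K)
    (homogeneousSubmodule (Fin l) K m →ₗ[K] MvPolynomial (Fin l) K) where
  carrier := {φ | ∀ h g, A.form x h ∣ g.1 → A.form x h ∣ φ g}
  add_mem' h1 h2 h g hg := dvd_add (h1 h g hg) (h2 h g hg)
  zero_mem' _ _ _ := dvd_zero _
  smul_mem' _ _ h1 h g hg := (h1 h g hg).mul_left _

theorem mem_diffModule_iff [CharZero K] {m : ℕ} (hm : 0 < m)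
    {θ : Module.End K (MvPolynomial (Fin l) K)} (hθ : θ ∈ diffOps K l m) :
    θ ∈ A.diffModule x m ↔ restrictHom K l m θ ∈ A.logHom x m := by
  obtain ⟨k, rfl⟩ : ∃ k, m = k + 1 := ⟨m - 1, by omega⟩
  constructor
  · rintro ⟨-, hQ⟩ h ⟨u, hu⟩ hd
    have hη : commMul (A.form x h) θ ∈ diffOps K l k := commMul_mem_diffOps hθ _
    have hdvd : ∀ g : MvPolynomial (Fin l) K, g.IsHomogeneous k →
        A.form x h ∣ commMul (A.form x h) θ g := by
      intro g hg
      rw [← support_sum_monomial_coeff g, map_sum]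
      refine Finset.dvd_sum fun b hb => ?_
      have h1 : monomial b (coeff b g) = coeff b g • monomial b (1 : K) := by simp [smul_monomial]
      rw [h1, map_smul, smul_eq_C_mul]
      refine (dvd_apply_of_dvd_apply_mul (A.prime_form x h) (A.not_form_dvd_cofactor x h) hη
        (fun f => ?_) b (degree_eq_of_mem_support hg hb)).mul_left _
      rw [commMul_apply, ← mul_assoc, A.form_mul_cofactor x h]
      exact dvd_sub ((Dvd.intro _ (A.form_mul_cofactor x h)).trans (hQ f)) (dvd_mul_right _ _)
    obtain ⟨g, hg, hug⟩ := exists_isHomogeneous_of_dvd (A.form_isHomogeneous x h)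
      (add_comm k 1 ▸ hu : u.IsHomogeneous (1 + k)) hd
    have h2 := hdvd g hg
    rw [commMul_apply] at h2
    rw [restrictHom_apply]
    dsimp only at hug ⊢
    rw [hug]
    exact (dvd_sub_left (dvd_mul_right _ _)).1 h2
  · intro hφ
    refine ⟨hθ, fun f => A.definingPolynomial_dvd x fun h => ?_⟩
    have hη : commMul (A.form x h) θ ∈ diffOps K l k := commMul_mem_diffOps hθ _
    have h1 := dvd_apply_of_dvd_apply_isHomogeneous (α := A.form x h) hη (fun g hg => by
      rw [commMul_apply]
      refine dvd_sub ?_ (dvd_mul_right _ _)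
      have hh : (A.form x h * g).IsHomogeneous (k + 1) := by
        rw [add_comm]; exact (A.form_isHomogeneous x h).mul hg
      exact hφ h ⟨A.form x h * g, hh⟩ (dvd_mul_right _ _)) (A.cofactor x h * f)
    rw [commMul_apply] at h1
    rw [← A.form_mul_cofactor x h, mul_assoc]
    exact (dvd_sub_left (dvd_mul_right _ _)).1 h1

end DiffModule

section LinearAlgebra

variable {K W ι : Type*} [Field K] [AddCommGroup W] [Module K W] [Fintype ι]

theorem exists_basis_mem_submodule (b : Module.Basis ι K W) (U : Submodule K W) :
    ∃ (c : Module.Basis ι K W) (T : Finset ι), T.card = Module.finrank K U ∧ ∀ k ∈ T, c k ∈ U := by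
  classical
  have := Module.Finite.of_basis b
  obtain ⟨U', hU⟩ := U.exists_isCompl
  let c₀ := ((Module.finBasis K U).prod (Module.finBasis K U')).map
    (Submodule.prodEquivOfIsCompl U U' hU)
  let e := c₀.indexEquiv b
  refine ⟨c₀.reindex e, Finset.univ.map (Function.Embedding.inl.trans e.toEmbedding), by simp, ?_⟩
  intro k hk
  obtain ⟨i, -, rfl⟩ := Finset.mem_map.1 hk
  simp [c₀, Submodule.coe_prodEquivOfIsCompl']

variable {S : Type*} [CommRing S] [Algebra K S] [DecidableEq ι]

theorem pow_finrank_dvd_det (b : Module.Basis ι K W) (U : Submodule K W) (α : S)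
    (φ : ι → W →ₗ[K] S) (h : ∀ i, ∀ u ∈ U, α ∣ φ i u) :
    α ^ Module.finrank K U ∣ (Matrix.of fun i j => φ i (b j)).det := by
  obtain ⟨c, T, hT, hc⟩ := exists_basis_mem_submodule b U
  have h1 : (Matrix.of fun i j => φ i (b j)) =
      (Matrix.of fun i j => φ i (c j)) * (c.toMatrix b).map (algebraMap K S) := by
    ext i j
    rw [Matrix.mul_apply, Matrix.of_apply]
    conv_lhs => rw [← c.sum_repr (b j)]
    simp [Module.Basis.toMatrix_apply, Algebra.smul_def, mul_comm, -Module.Basis.sum_repr]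
  have h2 : ∀ i j, ∃ r, φ i (c j) = (if j ∈ T then α else 1) * r := by
    intro i j
    split_ifs with hj
    · exact h i _ (hc j hj)
    · exact ⟨_, (one_mul _).symm⟩
  choose r hr using h2
  rw [h1, Matrix.det_mul]
  refine Dvd.dvd.mul_right ?_ _
  simp only [hr]
  have := Matrix.det_mul_row (fun j => if j ∈ T then α else 1) (Matrix.of r)
  simp only [Matrix.of_apply] at this
  rw [this, Finset.prod_ite_mem, Finset.univ_inter, Finset.prod_const, hT]
  exact dvd_mul_right _ _

end LinearAlgebra

section Saito

variable {K V : Type*} [Field K] [AddCommGroup V] [Module K V] {l : ℕ}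

instance finite_homogeneousSubmodule (m : ℕ) :
    Module.Finite K (homogeneousSubmodule (Fin l) K m) :=
  Module.Finite.iff_fg.2 (homogeneousSubmodule_fg _ _ m)

theorem finrank_homogeneousSubmodule (m : ℕ) :
    Module.finrank K (homogeneousSubmodule (Fin l) K m) = (m + l - 1).choose m := by
  classical
  rw [(LinearEquiv.ofEq _ _ (homogeneousSubmodule_eq_finsupp_supported (Fin l) K m)).finrank_eq,
    (AddMonoidAlgebra.supportedEquivFinsupp (R := K) (S := K)
      {d : Fin l →₀ ℕ | d.degree = m}).finrank_eq]
  have hs : {d : Fin l →₀ ℕ | d.degree = m} =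
      ((Finset.univ : Finset (Fin l)).finsuppAntidiag m : Set (Fin l →₀ ℕ)) := by
    ext d
    simp [Finset.mem_finsuppAntidiag, Finsupp.degree_eq_sum]
  rw [hs]
  have := Module.finrank_finsupp_self K
    (ι := ((Finset.univ : Finset (Fin l)).finsuppAntidiag m : Set (Fin l →₀ ℕ)))
  rw [this]
  simp [Finset.card_finsuppAntidiag_nat_eq_choose, add_comm]

/-- The homogeneous polynomials of degree `m` that are divisible by `q`. -/
noncomputable def dvdSubmodule (q : MvPolynomial (Fin l) K) (m : ℕ) :
    Submodule K (homogeneousSubmodule (Fin l) K m) where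
  carrier := {u | q ∣ u.1}
  add_mem' h1 h2 := dvd_add h1 h2
  zero_mem' := dvd_zero _
  smul_mem' c u h := by
    change q ∣ c • u.1
    rw [smul_eq_C_mul]
    exact Dvd.dvd.mul_left h _

theorem mem_dvdSubmodule {q : MvPolynomial (Fin l) K} {m : ℕ}
    {u : homogeneousSubmodule (Fin l) K m} : u ∈ dvdSubmodule q m ↔ q ∣ u.1 := Iff.rfl

theorem finrank_dvdSubmodule {q : MvPolynomial (Fin l) K} {d : ℕ} (hq : q.IsHomogeneous d)
    (hq0 : q ≠ 0) (e : ℕ) :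
    Module.finrank K (dvdSubmodule q (d + e)) =
      Module.finrank K (homogeneousSubmodule (Fin l) K e) := by
  let f : homogeneousSubmodule (Fin l) K e →ₗ[K] dvdSubmodule q (d + e) :=
    { toFun g := ⟨⟨q * g.1, hq.mul g.2⟩, dvd_mul_right _ _⟩
      map_add' g g' := by
        apply Subtype.ext; apply Subtype.ext; simp [mul_add]
      map_smul' c g := by
        apply Subtype.ext; apply Subtype.ext; simp }
  refine (LinearEquiv.ofBijective f ⟨?_, ?_⟩).finrank_eq.symm
  · intro g g' h
    have h1 : q * g.1 = q * g'.1 := congrArg (fun u => u.1.1) h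
    exact Subtype.ext (mul_left_cancel₀ hq0 h1)
  · rintro ⟨⟨u, hu⟩, hd⟩
    obtain ⟨g, hg, rfl⟩ := exists_isHomogeneous_of_dvd hq hu hd
    exact ⟨⟨g, hg⟩, rfl⟩

theorem dvdSubmodule_eq_bot {q : MvPolynomial (Fin l) K} {d m : ℕ} (hq : q.IsHomogeneous d)
    (hm : m < d) : dvdSubmodule q m = ⊥ := by
  rw [eq_bot_iff]
  rintro ⟨u, hu⟩ ⟨g, hg⟩
  dsimp only at hg
  rw [Submodule.mem_bot]
  apply Subtype.ext
  change u = 0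
  by_contra h0
  have h1 : g ≠ 0 := by rintro rfl; simp [h0] at hg
  have h2 : q ≠ 0 := by rintro rfl; simp [h0] at hg
  have h3 := congrArg totalDegree hg
  rw [totalDegree_mul_of_isDomain h2 h1, hq.totalDegree h2,
    IsHomogeneous.totalDegree (hu : u.IsHomogeneous m) h0] at h3
  omega

variable {ι : Type*} [Fintype ι] [DecidableEq ι]

theorem isHomogeneous_det {M : Matrix ι ι (MvPolynomial (Fin l) K)} {d : ι → ℕ}
    (h : ∀ i j, (M i j).IsHomogeneous (d i)) : M.det.IsHomogeneous (∑ i, d i) := by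
  rw [Matrix.det_apply]
  refine IsHomogeneous.sum _ _ _ fun σ _ => ?_
  rw [← mem_homogeneousSubmodule, Units.smul_def]
  refine zsmul_mem ?_ _
  rw [mem_homogeneousSubmodule, ← Equiv.sum_comp σ d]
  exact IsHomogeneous.prod _ _ _ fun i _ => h _ _

variable (A : CentralArrangement K V) (x : Module.Basis (Fin l) K (Module.Dual K V))

theorem definingPolynomial_pow_dvd_det {k : ℕ}
    (b : Module.Basis ι K (homogeneousSubmodule (Fin l) K (1 + k)))
    {φ : ι → homogeneousSubmodule (Fin l) K (1 + k) →ₗ[K] MvPolynomial (Fin l) K}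
    (hφ : ∀ i, φ i ∈ A.logHom x (1 + k)) :
    A.definingPolynomial x ^ (k + l - 1).choose k ∣ (Matrix.of fun i j => φ i (b j)).det := by
  refine A.definingPolynomial_pow_dvd x fun h => ?_
  rw [← finrank_homogeneousSubmodule (K := K),
    ← finrank_dvdSubmodule (A.form_isHomogeneous x h) (A.prime_form x h).ne_zero]
  exact pow_finrank_dvd_det b _ _ φ fun i u hu => hφ i h u hu

theorem linearIndependent_and_span_eq_logHom {k : ℕ}
    (b : Module.Basis ι K (homogeneousSubmodule (Fin l) K (1 + k)))
    {φ : ι → homogeneousSubmodule (Fin l) K (1 + k) →ₗ[K] MvPolynomial (Fin l) K}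
    (hφ : ∀ i, φ i ∈ A.logHom x (1 + k)) {d : ι → ℕ}
    (hd : ∀ i g, (φ i g).IsHomogeneous (d i))
    (hsum : ∑ i, d i = A.card * (k + l - 1).choose k)
    (hdet : (Matrix.of fun i j => φ i (b j)).det ≠ 0) :
    LinearIndependent (MvPolynomial (Fin l) K) φ ∧
      Submodule.span (MvPolynomial (Fin l) K) (Set.range φ) = A.logHom x (1 + k) := by
  set t := (k + l - 1).choose k
  set M : Matrix ι ι (MvPolynomial (Fin l) K) := Matrix.of fun i j => φ i (b j) with hM
  have hdvd : M.det ∣ A.definingPolynomial x ^ t := by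
    obtain ⟨c, hc⟩ := A.definingPolynomial_pow_dvd_det x b hφ
    have hQ : A.definingPolynomial x ^ t ≠ 0 := pow_ne_zero _ (A.definingPolynomial_ne_zero x)
    have hc0 : c ≠ 0 := by
      rintro rfl
      rw [mul_zero] at hc
      exact hdet hc
    have h1 := congrArg totalDegree hc
    rw [(isHomogeneous_det (M := M) fun i j => hd i (b j)).totalDegree hdet,
      totalDegree_mul_of_isDomain hQ hc0,
      ((A.definingPolynomial_isHomogeneous x).pow t).totalDegree hQ, hsum] at h1
    have h2 : c.totalDegree = 0 := by omega
    rw [totalDegree_eq_zero_iff_eq_C] at h2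
    have h3 : IsUnit c := by
      rw [h2]
      refine (isUnit_iff_ne_zero.2 fun h0 => hc0 ?_).map C
      rw [h2, h0, C_0]
    rw [hM, hc]
    exact h3.mul_right_dvd.2 dvd_rfl
  let ev : (homogeneousSubmodule (Fin l) K (1 + k) →ₗ[K] MvPolynomial (Fin l) K)
      →ₗ[MvPolynomial (Fin l) K] (ι → MvPolynomial (Fin l) K) :=
    { toFun ψ j := ψ (b j)
      map_add' _ _ := rfl
      map_smul' _ _ := rfl }
  have hev : Function.Injective ev := fun ψ ψ' h => b.ext fun j => congrFun h j
  refine ⟨?_, le_antisymm (Submodule.span_le.2 (Set.range_subset_iff.2 hφ)) fun ψ hψ => ?_⟩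
  · exact LinearIndependent.of_comp ev (Matrix.linearIndependent_rows_of_det_ne_zero hdet)
  · have h1 : ∀ i, ∃ r, M.transpose.cramer (ev ψ) i = M.det * r := by
      intro i
      refine hdvd.trans ?_
      have := A.definingPolynomial_pow_dvd_det x b (φ := Function.update φ i ψ) (fun i' => by
        by_cases h : i' = i
        · subst h; simpa using hψ
        · simpa [h] using hφ i')
      rw [Matrix.cramer_apply, Matrix.updateCol_transpose, Matrix.det_transpose]
      convert this using 2
      ext i' j
      by_cases h : i' = i
      · subst h; simp [ev]
      · simp [h, hM]
    choose r hr using h1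
    have h2 := Matrix.mulVec_cramer M.transpose (ev ψ)
    have h3 : ψ = ∑ i, r i • φ i := by
      apply hev
      rw [map_sum]
      ext1 j
      apply mul_left_cancel₀ hdet
      have h4 := congrFun h2 j
      rw [Matrix.det_transpose, Pi.smul_apply, smul_eq_mul] at h4
      rw [← h4]
      simp only [Matrix.mulVec, dotProduct, hr, Matrix.transpose_apply, Finset.sum_apply,
        map_smul, Pi.smul_apply, smul_eq_mul, Finset.mul_sum]
      refine Finset.sum_congr rfl fun i _ => ?_
      change φ i (b j) * _ = M.det * (r i * φ i (b j))
      ring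
    rw [h3]
    exact sum_mem fun i _ => Submodule.smul_mem _ _ (Submodule.subset_span ⟨i, rfl⟩)

end Saito

section Exponents

variable {K V : Type*} [Field K] [CharZero K] [AddCommGroup V] [Module K V] {l : ℕ}
  (A : CentralArrangement K V) (x : Module.Basis (Fin l) K (Module.Dual K V))

theorem isExponents_of_logHom_basis {m : ℕ} (hm : 0 < m)
    {φ : Fin ((m + l - 1).choose m) →
      homogeneousSubmodule (Fin l) K m →ₗ[K] MvPolynomial (Fin l) K}
    (hli : LinearIndependent (MvPolynomial (Fin l) K) φ)
    (hspan : Submodule.span (MvPolynomial (Fin l) K) (Set.range φ) = A.logHom x m)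
    {d : Fin ((m + l - 1).choose m) → ℕ} (hd : ∀ i g, (φ i g).IsHomogeneous (d i)) :
    A.IsExponents x m (Finset.univ.val.map d) := by
  choose f hf hφ using fun i => exists_restrictHom_eq (φ i)
  set θ := fun i => ∑ a ∈ Finset.piAntidiag (Finset.univ : Finset (Fin l)) m,
    f i a • partialPow K a
  have hθ : ∀ i, θ i ∈ diffOps K l m := fun i => sum_partialPow_mem_diffOps (f i)
  have hθφ : restrictHom K l m ∘ θ = φ := funext hφ
  refine ⟨θ, d, ⟨LinearIndependent.of_comp (restrictHom K l m) (hθφ ▸ hli), ?_⟩,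
    fun i => ⟨f i, hf i (d i) (hd i), rfl⟩, rfl⟩
  refine le_antisymm (Submodule.span_le.2 (Set.range_subset_iff.2 fun i => ?_)) fun η hη => ?_
  · refine (A.mem_diffModule_iff x hm (hθ i)).2 ?_
    rw [show restrictHom K l m (θ i) = φ i from hφ i, ← hspan]
    exact Submodule.subset_span ⟨i, rfl⟩
  · have h1 := (A.mem_diffModule_iff x hm hη.1).1 hη
    rw [← hspan, Submodule.mem_span_range_iff_exists_fun] at h1
    obtain ⟨r, hr⟩ := h1
    have h2 : η = ∑ i, r i • θ i := by
      refine restrictHom_injOn hη.1 (sum_mem fun i _ => Submodule.smul_mem _ _ (hθ i)) ?_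
      rw [map_sum, ← hr]
      refine Finset.sum_congr rfl fun i _ => ?_
      rw [map_smul, show restrictHom K l m (θ i) = φ i from hφ i]
    rw [h2]
    exact sum_mem fun i _ => Submodule.smul_mem _ _ (Submodule.subset_span ⟨i, rfl⟩)

theorem mem_span_of_hasDegree {m : ℕ} {ι : Type*} [Fintype ι]
    {θ : ι → Module.End K (MvPolynomial (Fin l) K)} {d : ι → ℕ}
    (hd : ∀ i, HasDegree m (θ i) (d i)) {η : Module.End K (MvPolynomial (Fin l) K)} {e : ℕ}
    (hη : HasDegree m η e)
    (hmem : η ∈ Submodule.span (MvPolynomial (Fin l) K) (Set.range θ)) :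
    η ∈ Submodule.span (MvPolynomial (Fin l) K) (θ '' {i | d i ≤ e}) := by
  rw [Submodule.mem_span_range_iff_exists_fun] at hmem
  obtain ⟨r, hr⟩ := hmem
  have h1 : η = ∑ i, (if d i ≤ e then homogeneousComponent (e - d i) (r i) else 0) • θ i := by
    refine restrictHom_injOn hη.mem_diffOps
      (sum_mem fun i _ => Submodule.smul_mem _ _ (hd i).mem_diffOps) ?_
    ext1 g
    rw [restrictHom_apply, restrictHom_apply,
      ← homogeneousComponent_eq_self (hη.isHomogeneous_apply g.2), ← hr, LinearMap.sum_apply,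
      LinearMap.sum_apply, map_sum]
    refine Finset.sum_congr rfl fun i _ => ?_
    rw [LinearMap.smul_apply, LinearMap.smul_apply, smul_eq_mul, smul_eq_mul,
      homogeneousComponent_mul_of_isHomogeneous _ _ ((hd i).isHomogeneous_apply g.2), ite_mul,
      zero_mul]
  rw [h1]
  refine sum_mem fun i _ => ?_
  split_ifs with h
  · exact Submodule.smul_mem _ _ (Submodule.subset_span ⟨i, h, rfl⟩)
  · rw [zero_smul]; exact zero_mem _


theorem card_degree_le_le {m : ℕ} {ι : Type*} [Fintype ι]
    {θ θ' : ι → Module.End K (MvPolynomial (Fin l) K)} {d d' : ι → ℕ}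
    (hd : ∀ i, HasDegree m (θ i) (d i)) (hd' : ∀ i, HasDegree m (θ' i) (d' i))
    (hli : LinearIndependent (MvPolynomial (Fin l) K) θ')
    (hmem : ∀ i, θ' i ∈ Submodule.span (MvPolynomial (Fin l) K) (Set.range θ)) (e : ℕ) :
    (Finset.univ.filter fun i => d' i ≤ e).card ≤ (Finset.univ.filter fun i => d i ≤ e).card := by
  classical
  have h1 := linearIndependent_le_span_aux' (fun i : {i // d' i ≤ e} => θ' i)
    (hli.comp _ Subtype.val_injective) ((Finset.univ.filter fun i => d i ≤ e).image θ) (by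
      rintro _ ⟨⟨i, hi⟩, rfl⟩
      refine Submodule.span_mono ?_ (mem_span_of_hasDegree hd (hd' i) (hmem i))
      rintro _ ⟨j, hj, rfl⟩
      have hj' : d j ≤ d' i := hj
      simp only [Finset.coe_image, Finset.coe_filter, Finset.mem_univ, true_and]
      exact ⟨j, hj'.trans hi, rfl⟩)
  rw [Fintype.card_subtype] at h1
  refine h1.trans (le_of_eq_of_le ?_ (Finset.card_image_le (f := θ)))
  exact Fintype.card_coe _

theorem map_univ_eq_of_card_le_eq {ι : Type*} [Fintype ι] {d d' : ι → ℕ}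
    (h : ∀ e, (Finset.univ.filter fun i => d' i ≤ e).card =
      (Finset.univ.filter fun i => d i ≤ e).card) :
    (Finset.univ : Finset ι).val.map d = Finset.univ.val.map d' := by
  classical
  have key : ∀ (d : ι → ℕ) (e : ℕ), (Finset.univ.filter fun i => d i ≤ e).card =
      (Finset.univ.filter fun i => d i < e).card + (Finset.univ.filter fun i => e = d i).card := by
    intro d e
    rw [← Finset.card_union_of_disjoint]
    · congr 1
      ext i
      simp only [Finset.mem_filter, Finset.mem_univ, true_and, Finset.mem_union]
      omega
    · rw [Finset.disjoint_filter]
      intro i _ h1 h2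
      omega
  have hlt : ∀ e, (Finset.univ.filter fun i => d' i < e).card =
      (Finset.univ.filter fun i => d i < e).card := by
    intro e
    cases e with
    | zero => simp
    | succ e => simpa [Nat.lt_succ_iff] using h e
  refine Multiset.ext.2 fun e => ?_
  rw [Multiset.count_map, Multiset.count_map]
  change (Finset.univ.filter fun i => e = d i).card = (Finset.univ.filter fun i => e = d' i).card
  have h1 := key d e
  have h2 := key d' e
  have h3 := h e
  have h4 := hlt e
  omega

theorem IsExponents.unique {m : ℕ} {E E' : Multiset ℕ} (h : A.IsExponents x m E)
    (h' : A.IsExponents x m E') : E = E' := by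
  obtain ⟨θ, d, ⟨hli, hspan⟩, hd, rfl⟩ := h
  obtain ⟨θ', d', ⟨hli', hspan'⟩, hd', rfl⟩ := h'
  refine map_univ_eq_of_card_le_eq fun e => le_antisymm ?_ ?_
  · refine card_degree_le_le hd hd' hli' (fun i => ?_) e
    rw [hspan, ← hspan']
    exact Submodule.subset_span ⟨i, rfl⟩
  · refine card_degree_le_le hd' hd hli (fun i => ?_) e
    rw [hspan', ← hspan]
    exact Submodule.subset_span ⟨i, rfl⟩

end Exponents

section LineSubst

variable {K : Type*} [Field K] {l : ℕ} {S : Type*} [CommRing S] [Algebra K S]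

/-- The substitution `x ↦ v + T y`, where `T` is the variable of the polynomial ring over `S`. -/
noncomputable def lineSubst (v : Fin l → K) (y : Fin l → S) :
    MvPolynomial (Fin l) K →ₐ[K] Polynomial S :=
  aeval fun i => Polynomial.C (algebraMap K S (v i)) + Polynomial.X * Polynomial.C (y i)

theorem lineSubst_X (v : Fin l → K) (y : Fin l → S) (i : Fin l) :
    lineSubst v y (X i) =
      Polynomial.C (algebraMap K S (v i)) + Polynomial.X * Polynomial.C (y i) :=
  aeval_X _ _

theorem lineSubst_toPolynomial {V : Type*} [AddCommGroup V] [Module K V]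
    (x : Module.Basis (Fin l) K (Module.Dual K V)) (v : Fin l → K) (y : Fin l → S)
    (α : Module.Dual K V) :
    lineSubst v y (toPolynomial x α) =
      Polynomial.C (algebraMap K S (eval v (toPolynomial x α))) +
        Polynomial.X * Polynomial.C (aeval y (toPolynomial x α)) := by
  have hC : ∀ c : K, lineSubst v y (C c) = Polynomial.C (algebraMap K S c) := fun c =>
    algHom_C _ c
  simp only [toPolynomial, map_sum, map_mul, lineSubst_X, hC, eval_C, eval_X, aeval_X, algHom_C,
    Finset.mul_sum, ← Finset.sum_add_distrib]
  refine Finset.sum_congr rfl fun i _ => ?_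
  ring

theorem map_eval_lineSubst (v p : Fin l → K) (g : MvPolynomial (Fin l) K) :
    (lineSubst v (X : Fin l → MvPolynomial (Fin l) K) g).map (eval p) = lineSubst v p g := by
  induction g using MvPolynomial.induction_on with
  | C c => simp [lineSubst, algHom_C, Polynomial.algebraMap_apply, MvPolynomial.algebraMap_eq]
  | add f g hf hg => rw [map_add, map_add, Polynomial.map_add, hf, hg]
  | mul_X f i hf =>
    rw [map_mul, map_mul, Polynomial.map_mul, hf, lineSubst_X, lineSubst_X]
    simp [MvPolynomial.algebraMap_eq]

theorem isHomogeneous_coeff_lineSubst (v : Fin l → K) (g : MvPolynomial (Fin l) K) (j : ℕ) :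
    ((lineSubst v (X : Fin l → MvPolynomial (Fin l) K) g).coeff j).IsHomogeneous j := by
  induction g using MvPolynomial.induction_on generalizing j with
  | C c =>
    have : lineSubst v (X : Fin l → MvPolynomial (Fin l) K) (C c) = Polynomial.C (C c) :=
      algHom_C _ c
    rw [this, Polynomial.coeff_C]
    split_ifs with h
    · subst h; exact isHomogeneous_C _ _
    · exact isHomogeneous_zero _ _ _
  | add f g hf hg => rw [map_add, Polynomial.coeff_add]; exact (hf j).add (hg j)
  | mul_X f i hf =>
    rw [map_mul, lineSubst_X, mul_add, Polynomial.coeff_add, Polynomial.coeff_mul_C, ← mul_assoc,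
      Polynomial.coeff_mul_C]
    refine IsHomogeneous.add ?_ ?_
    · exact (hf j).mul (isHomogeneous_C _ _)
    · cases j with
      | zero => simpa using isHomogeneous_zero _ _ _
      | succ j =>
        rw [Polynomial.coeff_mul_X]
        exact (hf j).mul (isHomogeneous_X _ _)

/-- The functional `g ↦ [T^j] g(v + T p)` on the homogeneous polynomials of degree `m`. -/
noncomputable def lineCoeff (m : ℕ) (v p : Fin l → K) (j : ℕ) :
    Module.Dual K (homogeneousSubmodule (Fin l) K m) :=
  Polynomial.lcoeff K j ∘ₗ (lineSubst v p).toLinearMap ∘ₗ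
    (homogeneousSubmodule (Fin l) K m).subtype

theorem lineCoeff_apply (m : ℕ) (v p : Fin l → K) (j : ℕ)
    (g : homogeneousSubmodule (Fin l) K m) :
    lineCoeff m v p j g = (lineSubst v p g.1).coeff j := rfl

end LineSubst

section Realizable

variable {K V : Type*} [Field K] [AddCommGroup V] [Module K V] {l : ℕ}
  (A : CentralArrangement K V) (x : Module.Basis (Fin l) K (Module.Dual K V))

/-- `f` is the value at the point `p` of a homogeneous element of degree `d` of `logHom`. -/
def IsRealizable (m : ℕ) (p : Fin l → K) (f : Module.Dual K (homogeneousSubmodule (Fin l) K m))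
    (d : ℕ) : Prop :=
  ∃ φ ∈ A.logHom x m, (∀ g, (φ g).IsHomogeneous d) ∧ ∀ g, eval p (φ g) = f g

theorem isRealizable_of_form_dvd {m : ℕ} {p : Fin l → K}
    {f : Module.Dual K (homogeneousSubmodule (Fin l) K m)} {P : MvPolynomial (Fin l) K} {d : ℕ}
    (hP : P.IsHomogeneous d) (hp : eval p P ≠ 0)
    (h : ∀ h, A.form x h ∣ P ∨ ∀ u ∈ dvdSubmodule (A.form x h) m, f u = 0) :
    A.IsRealizable x m p f d := by
  refine ⟨{ toFun g := C (f g * (eval p P)⁻¹) * P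
            map_add' g g' := by rw [map_add, add_mul, C_add, add_mul]
            map_smul' c g := by
              rw [map_smul, smul_eq_mul, mul_assoc, C_mul, mul_assoc, RingHom.id_apply,
                smul_eq_C_mul] }, fun h' g hg => ?_, fun g => hP.C_mul _, fun g => ?_⟩
  · rcases h h' with h1 | h1
    · exact h1.mul_left _
    · simp [h1 g hg]
  · simp [hp]

theorem isRealizable_lineCoeff {m : ℕ} {v p : Fin l → K} (j : ℕ) {P : MvPolynomial (Fin l) K}
    {d : ℕ} (hP : P.IsHomogeneous d) (hp : eval p P ≠ 0)
    (h : ∀ h, A.form x h ∣ P ∨ eval v (A.form x h) = 0) :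
    A.IsRealizable x m p (lineCoeff m v p j) (j + d) := by
  refine ⟨{ toFun g := C ((eval p P)⁻¹) *
              ((lineSubst v (X : Fin l → MvPolynomial (Fin l) K) g.1).coeff j * P)
            map_add' g g' := by
              rw [Submodule.coe_add, map_add, Polynomial.coeff_add, add_mul, mul_add]
            map_smul' c g := by
              rw [Submodule.coe_smul, map_smul, Polynomial.coeff_smul, RingHom.id_apply,
                smul_mul_assoc, mul_smul_comm] }, fun h' g hg => ?_, fun g => ?_, fun g => ?_⟩
  · refine Dvd.dvd.mul_left ?_ _
    rcases h h' with h1 | h1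
    · exact h1.mul_left _
    · refine Dvd.dvd.mul_right ?_ _
      have h2 : Polynomial.C (A.form x h') ∣
          lineSubst v (X : Fin l → MvPolynomial (Fin l) K) g.1 := by
        refine Dvd.dvd.trans ?_ (map_dvd _ hg)
        rw [form, lineSubst_toPolynomial, aeval_X_left_apply]
        rw [form] at h1
        rw [h1, map_zero, map_zero, zero_add]
        exact dvd_mul_left _ _
      exact (Polynomial.C_dvd_iff_dvd_coeff _ _).1 h2 j
  · exact ((isHomogeneous_coeff_lineSubst v g.1 j).mul hP).C_mul _
  · rw [LinearMap.coe_mk, AddHom.coe_mk, map_mul, map_mul, eval_C, lineCoeff_apply,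
      ← map_eval_lineSubst v p, Polynomial.coeff_map]
    field_simp

theorem isExponents_of_isRealizable [CharZero K] {k : ℕ} {p : Fin l → K} {ι : Type*} [Fintype ι]
    (hcard : Fintype.card ι = (1 + k + l - 1).choose (1 + k))
    {f : ι → Module.Dual K (homogeneousSubmodule (Fin l) K (1 + k))} {d : ι → ℕ}
    (hf : LinearIndependent K f) (hfd : ∀ i, A.IsRealizable x (1 + k) p (f i) (d i))
    (hsum : ∑ i, d i = A.card * (k + l - 1).choose k) :
    A.IsExponents x (1 + k) (Finset.univ.val.map d) := by
  classical
  let e := (Fintype.equivFinOfCardEq hcard).symm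
  have hE : (Finset.univ : Finset ι).val.map d = Finset.univ.val.map (d ∘ e) := by
    rw [← Finset.map_univ_equiv e, Finset.map_val, Multiset.map_map]
    rfl
  rw [hE]
  choose φ hφ hd hev using fun i => hfd (e i)
  let b : Module.Basis (Fin ((1 + k + l - 1).choose (1 + k))) K
      (homogeneousSubmodule (Fin l) K (1 + k)) :=
    Module.finBasisOfFinrankEq _ _ (finrank_homogeneousSubmodule (1 + k))
  have hdet : (Matrix.of fun i j => φ i (b j)).det ≠ 0 := by
    intro h0
    have h1 := congrArg (eval p) h0
    rw [map_zero, RingHom.map_det] at h1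
    have h2 : LinearIndependent K
        (fun i => (eval p).mapMatrix (Matrix.of fun i j => φ i (b j)) i) := by
      have h3 := (hf.comp e e.injective).map' (b.constr K).symm.toLinearMap
        (LinearEquiv.ker _)
      have heq : (fun i => (eval p).mapMatrix (Matrix.of fun i j => φ i (b j)) i) =
          (b.constr K).symm.toLinearMap ∘ f ∘ e := by
        ext i j
        simp [hev, Module.Basis.constr]
      rw [heq]
      exact h3
    have h4 := Matrix.linearIndependent_rows_iff_isUnit.1 h2
    rw [Matrix.isUnit_iff_isUnit_det, h1] at h4
    exact not_isUnit_zero h4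
  have h5 := A.linearIndependent_and_span_eq_logHom x b hφ hd
    (by rw [← hsum]; exact Equiv.sum_comp e d) hdet
  exact A.isExponents_of_logHom_basis x (by omega) h5.1 h5.2 hd

end Realizable

section Extension

variable {K W : Type*} [Field K] [AddCommGroup W] [Module K W] [FiniteDimensional K W]

theorem exists_linearIndependent_sumElim {ι : Type*} [Fintype ι] {f : ι → W}
    (hf : LinearIndependent K f) (G : Set W) (e : ℕ)
    (he : Fintype.card ι + e ≤ Module.finrank K (Submodule.span K G)) :
    ∃ g : Fin e → W, (∀ i, g i ∈ G) ∧ LinearIndependent K (Sum.elim f g) := by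
  classical
  obtain ⟨B, hBT, hB, hspan, hli⟩ := exists_linearIndepOn_id_extension
    (t := Set.range f ∪ G) hf.linearIndepOn_id Set.subset_union_left
  have hli' : LinearIndependent K (fun b : B => (b : W)) := hli
  have hfin : B.Finite := hli'.setFinite
  have h1 : Module.finrank K (Submodule.span K G) ≤ B.ncard := by
    have := hfin.fintype
    rw [Set.ncard_eq_toFinset_card', ← finrank_span_set_eq_card hli']
    exact Submodule.finrank_mono (Submodule.span_le.2 (Set.subset_union_right.trans hspan))
  have h2 : (Set.range f).ncard ≤ Fintype.card ι := by
    rw [← Set.image_univ, ← Nat.card_eq_fintype_card, ← Set.ncard_univ]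
    exact Set.ncard_image_le
  have h3 := Set.ncard_le_ncard_sdiff_add_ncard B (Set.range f)
  have := (hfin.subset (Set.sdiff_subset (t := Set.range f))).fintype
  have h4 : e ≤ Fintype.card (B \ Set.range f : Set W) := by
    rw [← Nat.card_eq_fintype_card, Nat.card_coe_set_eq]
    omega
  obtain ⟨g⟩ : Nonempty (Fin e ↪ (B \ Set.range f : Set W)) :=
    Function.Embedding.nonempty_of_card_le (by simpa using h4)
  refine ⟨fun i => g i, fun i => (hBT (g i).2.1).resolve_left (g i).2.2, ?_⟩
  have hmem : ∀ i, Sum.elim f (fun i => (g i : W)) i ∈ B := by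
    rintro (i | i)
    · exact hB ⟨i, rfl⟩
    · exact (g i).2.1
  have hinj : Function.Injective fun i => (⟨_, hmem i⟩ : B) := by
    rintro (i | i) (j | j) h <;> simp only [Subtype.mk.injEq, Sum.elim_inl, Sum.elim_inr] at h
    · rw [hf.injective h]
    · exact ((g j).2.2 ⟨i, h⟩).elim
    · exact ((g i).2.2 ⟨j, h.symm⟩).elim
    · rw [g.injective (Subtype.ext h)]
  exact hli'.comp _ hinj

end Extension

section Combinatorics

variable {K V : Type*} [Field K] [AddCommGroup V] [Module K V]
  (A : CentralArrangement K V)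

theorem mem_lattice {X : Submodule K V} :
    X ∈ A.lattice ↔ ∃ B ⊆ A.hyperplanes, B.inf id = X := by
  simp [lattice]

theorem mem_lattice₁ {X : Submodule K V} :
    X ∈ A.lattice₁ ↔ X ∈ A.lattice ∧ Module.finrank K X = 1 := by
  simp [lattice₁]

theorem mem_lattice_of_mem_hyperplanes {H : Submodule K V} (hH : H ∈ A.hyperplanes) :
    H ∈ A.lattice :=
  A.mem_lattice.2 ⟨{H}, by simpa using hH, by simp⟩

theorem inf_mem_lattice {X Y : Submodule K V} (hX : X ∈ A.lattice) (hY : Y ∈ A.lattice) :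
    X ⊓ Y ∈ A.lattice := by
  classical
  obtain ⟨B, hB, rfl⟩ := A.mem_lattice.1 hX
  obtain ⟨C, hC, rfl⟩ := A.mem_lattice.1 hY
  exact A.mem_lattice.2 ⟨B ∪ C, Finset.union_subset hB hC, Finset.inf_union⟩

theorem mem_localization {X H : Submodule K V} :
    H ∈ (A.localization X).hyperplanes ↔ H ∈ A.hyperplanes ∧ X ≤ H := by
  simp [localization]

theorem card_localization_le (X : Submodule K V) : (A.localization X).card ≤ A.card :=
  Finset.card_le_card fun _ hH => (A.mem_localization.1 hH).1

open Classical in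
theorem card_filter_le (X : Submodule K V) :
    (Finset.univ.filter fun h : A.hyperplanes => X ≤ h.1).card = (A.localization X).card := by
  rw [card, ← Finset.card_map (Function.Embedding.subtype _)]
  congr 1
  ext H
  simp [mem_localization, and_comm]

variable (hV : Module.finrank K V = 3)
include hV

theorem finiteDimensional_of_finrank_eq_three : FiniteDimensional K V :=
  FiniteDimensional.of_finrank_pos (by omega)

theorem finrank_hyperplane {H : Submodule K V} (hH : H ∈ A.hyperplanes) :
    Module.finrank K H = 2 := by
  have := finiteDimensional_of_finrank_eq_three hV
  have h1 := Submodule.finrank_quotient_add_finrank H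
  rw [A.codim_one H hH, hV] at h1
  omega

theorem hyperplane_eq_of_le {X Y H H' : Submodule K V} (hX : Module.finrank K X = 1)
    (hY : Module.finrank K Y = 1) (hXY : X ≠ Y) (hH : H ∈ A.hyperplanes)
    (hH' : H' ∈ A.hyperplanes) (hXH : X ≤ H) (hYH : Y ≤ H) (hXH' : X ≤ H') (hYH' : Y ≤ H') :
    H = H' := by
  have := finiteDimensional_of_finrank_eq_three hV
  have h1 := Submodule.finrank_sup_add_finrank_inf_eq X Y
  have h2 : Module.finrank K (X ⊓ Y : Submodule K V) < 1 := by
    rw [← hX]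
    refine Submodule.finrank_lt_finrank_of_lt (lt_of_le_of_ne inf_le_left fun h => hXY ?_)
    exact Submodule.eq_of_le_of_finrank_eq (inf_eq_left.1 h) (hX.trans hY.symm)
  have h3 : Module.finrank K (X ⊔ Y : Submodule K V) = 2 := by omega
  rw [← Submodule.eq_of_le_of_finrank_eq (sup_le hXH hYH)
      (h3.trans (A.finrank_hyperplane hV hH).symm),
    ← Submodule.eq_of_le_of_finrank_eq (sup_le hXH' hYH')
      (h3.trans (A.finrank_hyperplane hV hH').symm)]

theorem finrank_inf_hyperplane {X H : Submodule K V} (hH : H ∈ A.hyperplanes) (hXH : ¬ X ≤ H) :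
    Module.finrank K (X ⊓ H : Submodule K V) + 1 = Module.finrank K X := by
  have := finiteDimensional_of_finrank_eq_three hV
  have h1 := Submodule.finrank_sup_add_finrank_inf_eq X H
  have h2 := Submodule.finrank_lt_finrank_of_lt (right_lt_sup.2 hXH)
  have h3 := Submodule.finrank_le (X ⊔ H)
  rw [A.finrank_hyperplane hV hH] at h1 h2
  omega

theorem finrank_inf_eq_one {H H' : Submodule K V} (hH : H ∈ A.hyperplanes)
    (hH' : H' ∈ A.hyperplanes) (hne : H ≠ H') : Module.finrank K (H ⊓ H' : Submodule K V) = 1 := by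
  have := finiteDimensional_of_finrank_eq_three hV
  have h1 := A.finrank_inf_hyperplane hV hH' (X := H) fun hle => hne
    (Submodule.eq_of_le_of_finrank_eq hle
      ((A.finrank_hyperplane hV hH).trans (A.finrank_hyperplane hV hH').symm))
  rw [A.finrank_hyperplane hV hH] at h1
  omega

theorem sum_choose_two_card_localization :
    ∑ X ∈ A.lattice₁, (A.localization X).card.choose 2 = A.card.choose 2 := by
  classical
  have := finiteDimensional_of_finrank_eq_three hV
  have hfin : ∀ B ∈ A.hyperplanes.powersetCard 2,
      Module.finrank K (B.inf id : Submodule K V) = 1 := by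
    intro B hB
    obtain ⟨hBA, hcard⟩ := Finset.mem_powersetCard.1 hB
    obtain ⟨H, H', hne, rfl⟩ := Finset.card_eq_two.1 hcard
    rw [Finset.inf_insert, Finset.inf_singleton, id, id]
    exact A.finrank_inf_eq_one hV (hBA (by simp)) (hBA (by simp)) hne
  rw [card, ← Finset.card_powersetCard, Finset.card_eq_sum_card_fiberwise
    (f := fun B => B.inf id) (t := A.lattice₁)]
  · refine Finset.sum_congr rfl fun X hX => ?_
    rw [card, ← Finset.card_powersetCard]
    congr 1
    ext B
    simp only [Finset.mem_powersetCard, Finset.mem_filter]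
    constructor
    · rintro ⟨hB, hcard⟩
      have hBA : B ⊆ A.hyperplanes := fun H hH => (A.mem_localization.1 (hB hH)).1
      refine ⟨⟨hBA, hcard⟩, (Submodule.eq_of_le_of_finrank_eq
        (Finset.le_inf fun H hH => (A.mem_localization.1 (hB hH)).2) ?_).symm⟩
      exact (A.mem_lattice₁.1 hX).2.trans (hfin B (Finset.mem_powersetCard.2 ⟨hBA, hcard⟩)).symm
    · rintro ⟨⟨hBA, hcard⟩, rfl⟩
      exact ⟨fun H hH => A.mem_localization.2 ⟨hBA hH, Finset.inf_le hH⟩, hcard⟩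
  · intro B hB
    exact A.mem_lattice₁.2 ⟨A.mem_lattice.2 ⟨B, (Finset.mem_powersetCard.1 hB).1, rfl⟩, hfin B hB⟩

end Combinatorics

section TestPolynomials

variable {K V : Type*} [Field K] [AddCommGroup V] [Module K V] {l : ℕ}
  (A : CentralArrangement K V) (x : Module.Basis (Fin l) K (Module.Dual K V))

theorem eval_form_eq_zero_iff {X : Submodule K V} {w : V} (hX : X = Submodule.span K {w})
    (h : A.hyperplanes) : eval (fun i => x i w) (A.form x h) = 0 ↔ X ≤ h.1 := by
  rw [form, eval_toPolynomial, hX, Submodule.span_singleton_le_iff_mem, ← A.ker_linearForm h,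
    LinearMap.mem_ker]

theorem lineSubst_form (v p : Fin l → K) (h : A.hyperplanes) :
    lineSubst v p (A.form x h) = Polynomial.C (eval v (A.form x h)) +
      Polynomial.X * Polynomial.C (eval p (A.form x h)) :=
  lineSubst_toPolynomial x v p _

theorem exists_coordinate_ne_zero {w : V} (hw : w ≠ 0) [FiniteDimensional K V] :
    ∃ i, x i w ≠ 0 := by
  by_contra! h
  apply hw
  rw [← Module.forall_dual_apply_eq_zero_iff K]
  intro f
  rw [← x.sum_repr f]
  simp [h, LinearMap.sum_apply, -Module.Basis.sum_repr]

open Classical in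
/-- The product of the forms of the hyperplanes that do not contain `X`. -/
noncomputable def awayForm (X : Submodule K V) : MvPolynomial (Fin l) K :=
  ∏ h ∈ Finset.univ.filter (fun h : A.hyperplanes => ¬ X ≤ h.1), A.form x h

theorem awayForm_isHomogeneous (X : Submodule K V) :
    (A.awayForm x X).IsHomogeneous (A.card - (A.localization X).card) := by
  classical
  have h1 := IsHomogeneous.prod (Finset.univ.filter (fun h : A.hyperplanes => ¬ X ≤ h.1))
    (A.form x) (fun _ => 1) fun h _ => A.form_isHomogeneous x h
  have h2 := Finset.card_filter_add_card_filter_not (s := (Finset.univ : Finset A.hyperplanes))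
    (fun h => X ≤ h.1)
  rw [A.card_filter_le X, Finset.card_univ, Fintype.card_coe] at h2
  rw [Finset.sum_const, smul_eq_mul, mul_one] at h1
  rw [awayForm, card]
  convert h1 using 1
  omega

theorem eval_definingPolynomial_ne_zero_iff {p : Fin l → K} :
    eval p (A.definingPolynomial x) ≠ 0 ↔ ∀ h, eval p (A.form x h) ≠ 0 := by
  rw [definingPolynomial_eq, map_prod, Finset.prod_ne_zero_iff]
  simp

theorem form_dvd_awayForm {X : Submodule K V} {h : A.hyperplanes} (hX : ¬ X ≤ h.1) :
    A.form x h ∣ A.awayForm x X := by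
  classical
  exact Finset.dvd_prod_of_mem _ (by simpa using hX)

theorem eval_awayForm_ne_zero {p : Fin l → K} (X : Submodule K V)
    (hp : ∀ h, eval p (A.form x h) ≠ 0) : eval p (A.awayForm x X) ≠ 0 := by
  rw [awayForm, map_prod, Finset.prod_ne_zero_iff]
  exact fun h _ => hp h

theorem lineSubst_awayForm_coeff_zero {X : Submodule K V} {w : V} (hX : X = Submodule.span K {w})
    (p : Fin l → K) :
    (lineSubst (fun i => x i w) p (A.awayForm x X)).coeff 0 ≠ 0 := by
  classical
  rw [awayForm, map_prod, Polynomial.coeff_zero_prod, Finset.prod_ne_zero_iff]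
  intro h hh
  rw [lineSubst_form]
  simpa using (A.eval_form_eq_zero_iff x hX h).not.2 (by simpa using hh)

theorem X_pow_dvd_lineSubst_awayForm (hV : Module.finrank K V = 3) {X Y : Submodule K V} {w : V}
    (hX : Module.finrank K X = 1) (hY1 : Module.finrank K Y = 1)
    (hY : Y = Submodule.span K {w}) (hXY : X ≠ Y) (p : Fin l → K) :
    Polynomial.X ^ ((A.localization Y).card - 1) ∣
      lineSubst (fun i => x i w) p (A.awayForm x X) := by
  classical
  have h1 : (A.localization Y).card - 1 ≤
      (Finset.univ.filter fun h : A.hyperplanes => ¬ X ≤ h.1 ∧ Y ≤ h.1).card := by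
    have h2 := Finset.card_filter_add_card_filter_not
      (s := Finset.univ.filter fun h : A.hyperplanes => Y ≤ h.1) (fun h => X ≤ h.1)
    rw [A.card_filter_le Y, Finset.filter_filter, Finset.filter_filter] at h2
    have h3 : (Finset.univ.filter fun h : A.hyperplanes => Y ≤ h.1 ∧ X ≤ h.1).card ≤ 1 := by
      refine Finset.card_le_one.2 fun h hh h' hh' => Subtype.ext ?_
      simp only [Finset.mem_filter, Finset.mem_univ, true_and] at hh hh'
      exact A.hyperplane_eq_of_le hV hX hY1 hXY h.2 h'.2 hh.2 hh.1 hh'.2 hh'.1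
    simp only [and_comm (a := ¬ _)]
    omega
  refine (pow_dvd_pow _ h1).trans ?_
  rw [← Finset.prod_const, awayForm, map_prod]
  refine (Finset.prod_dvd_prod_of_dvd _ (fun h => lineSubst (fun i => x i w) p (A.form x h))
    fun h hh => ?_).trans (Finset.prod_dvd_prod_of_subset _ _ _ fun h hh => ?_)
  · simp only [Finset.mem_filter, Finset.mem_univ, true_and] at hh
    rw [lineSubst_form, (A.eval_form_eq_zero_iff x hY h).2 hh.2, map_zero, zero_add]
    exact dvd_mul_right _ _
  · simp only [Finset.mem_filter, Finset.mem_univ, true_and] at hh ⊢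
    exact hh.1

theorem exists_lineCoeff_test (hV : Module.finrank K V = 3) {m : ℕ} (hm : A.card ≤ m + 2)
    {p : Fin l → K} (hp : ∀ h, eval p (A.form x h) ≠ 0) {X : Submodule K V} {w : V}
    (hw : w ≠ 0) (hX1 : Module.finrank K X = 1) (hX : X = Submodule.span K {w}) {j : ℕ}
    (hj : j < (A.localization X).card - 1) :
    ∃ f : homogeneousSubmodule (Fin l) K m,
      (∀ i < j, lineCoeff m (fun i => x i w) p i f = 0) ∧
      lineCoeff m (fun i => x i w) p j f ≠ 0 ∧
      ∀ (Y : Submodule K V) (u : V), Module.finrank K Y = 1 → Y = Submodule.span K {u} → X ≠ Y →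
        ∀ i < (A.localization Y).card - 1, lineCoeff m (fun i => x i u) p i f = 0 := by
  classical
  have := finiteDimensional_of_finrank_eq_three hV
  obtain ⟨i₀, hi₀⟩ := exists_coordinate_ne_zero x hw
  obtain ⟨H, hH⟩ : (A.localization X).hyperplanes.Nonempty := by
    rw [← Finset.card_pos]
    change 0 < (A.localization X).card
    omega
  rw [mem_localization] at hH
  let h₀ : A.hyperplanes := ⟨H, hH.1⟩
  have hle := A.card_localization_le X
  set r := m - (A.card - (A.localization X).card + j) with hr
  have hhom : (A.awayForm x X * A.form x h₀ ^ j * MvPolynomial.X i₀ ^ r).IsHomogeneous m := by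
    have h1 := ((A.awayForm_isHomogeneous x X).mul ((A.form_isHomogeneous x h₀).pow j)).mul
      ((isHomogeneous_X K i₀).pow r)
    convert h1 using 1
    omega
  refine ⟨⟨_, hhom⟩, ?_⟩
  have hL : ∀ v, lineSubst v p (A.awayForm x X * A.form x h₀ ^ j * MvPolynomial.X i₀ ^ r) =
      lineSubst v p (A.awayForm x X) * lineSubst v p (A.form x h₀) ^ j *
        lineSubst v p (MvPolynomial.X i₀) ^ r := fun v => by
    rw [map_mul, map_mul, map_pow, map_pow]
  have hX2 : lineSubst (fun i => x i w) p
      (A.awayForm x X * A.form x h₀ ^ j * MvPolynomial.X i₀ ^ r) =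
      Polynomial.X ^ j * (lineSubst (fun i => x i w) p (A.awayForm x X) *
        Polynomial.C (eval p (A.form x h₀)) ^ j *
        lineSubst (fun i => x i w) p (MvPolynomial.X i₀) ^ r) := by
    rw [hL, lineSubst_form, (A.eval_form_eq_zero_iff x hX h₀).2 hH.2, map_zero, zero_add, mul_pow]
    ring
  refine ⟨fun i hi => ?_, ?_, fun Y u hY1 hY hXY i hi => ?_⟩
  · rw [lineCoeff_apply]
    dsimp only
    rw [hX2]
    exact Polynomial.X_pow_dvd_iff.1 (dvd_mul_right _ _) i hi
  · rw [lineCoeff_apply]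
    dsimp only
    rw [hX2, Polynomial.coeff_X_pow_mul', if_pos le_rfl, Nat.sub_self, Polynomial.mul_coeff_zero,
      Polynomial.mul_coeff_zero, lineSubst_X]
    refine mul_ne_zero (mul_ne_zero (A.lineSubst_awayForm_coeff_zero x hX p) ?_) ?_
    · rw [← map_pow, Polynomial.coeff_C_zero]
      exact pow_ne_zero _ (hp h₀)
    · rw [Polynomial.coeff_zero_eq_eval_zero]
      simpa using fun h => (hi₀ h).elim
  · rw [lineCoeff_apply]
    dsimp only
    rw [hL, mul_assoc]
    exact Polynomial.X_pow_dvd_iff.1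
      ((A.X_pow_dvd_lineSubst_awayForm x hV hX1 hY1 hY hXY p).mul_right _) i hi

theorem linearIndependent_lineCoeff (hV : Module.finrank K V = 3) {m : ℕ} (hm : A.card ≤ m + 2)
    {p : Fin l → K} (hp : ∀ h, eval p (A.form x h) ≠ 0) {w : A.lattice₁ → V} (hw : ∀ X, w X ≠ 0)
    (hX : ∀ X, X.1 = Submodule.span K {w X}) :
    LinearIndependent K fun t : Σ X : A.lattice₁, Fin ((A.localization X.1).card - 1) =>
      lineCoeff m (fun i => x i (w t.1)) p t.2 := by
  classical
  rw [Fintype.linearIndependent_iff]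
  intro c hc
  by_contra! hne
  obtain ⟨t₀, ht₀⟩ := hne
  obtain ⟨t, ht, hmax⟩ := Finset.exists_max_image (Finset.univ.filter fun t => c t ≠ 0)
    (fun t => (t.2 : ℕ)) ⟨t₀, by simpa using ht₀⟩
  simp only [Finset.mem_filter, Finset.mem_univ, true_and] at ht hmax
  have hfr : ∀ X : A.lattice₁, Module.finrank K X.1 = 1 := fun X => (A.mem_lattice₁.1 X.2).2
  obtain ⟨f, hf1, hf2, hf3⟩ := A.exists_lineCoeff_test x hV hm hp (hw t.1) (hfr t.1) (hX t.1) t.2.2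
  have h1 := LinearMap.congr_fun hc f
  rw [LinearMap.sum_apply, Finset.sum_eq_single t] at h1
  · exact mul_ne_zero ht hf2 h1
  · intro s _ hst
    by_cases hcs : c s = 0
    · rw [hcs, zero_smul, LinearMap.zero_apply]
    rw [LinearMap.smul_apply]
    by_cases hs : s.1 = t.1
    · have hlt : (s.2 : ℕ) < t.2 := by
        refine lt_of_le_of_ne (hmax s hcs) fun h => hst ?_
        obtain ⟨sX, sj⟩ := s
        obtain ⟨tX, tj⟩ := t
        obtain rfl : sX = tX := hs
        exact congrArg _ (Fin.ext h)
      have hz := hf1 _ hlt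
      rw [← hs] at hz
      rw [hz, smul_zero]
    · rw [hf3 s.1 (w s.1) (hfr _) (hX _) (fun h => hs (Subtype.ext h.symm)) _ s.2.2, smul_zero]
  · simp

end TestPolynomials

section Arithmetic

theorem sum_range_add_choose_two (q s : ℕ) :
    ∑ j ∈ Finset.range q, (j + s) + (q + 1).choose 2 = (q + s) * q := by
  induction q with
  | zero => simp
  | succ q ih =>
    have h1 : (q + 1 + 1).choose 2 = (q + 1) + (q + 1).choose 2 := by
      rw [Nat.choose_succ_succ' (q + 1) 1, Nat.choose_one_right]
    rw [Finset.sum_range_succ, h1]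
    linarith [ih]

theorem sum_degrees_add_choose_two {n k : ℕ} (hk : k ≤ n) :
    ∑ j ∈ Finset.range (k - 1), (j + n - k) + k.choose 2 = (n - 1) * (k - 1) := by
  cases k with
  | zero => simp
  | succ q =>
    obtain ⟨s, rfl⟩ := Nat.exists_eq_add_of_le hk
    have h1 := sum_range_add_choose_two q s
    rw [show q + 1 - 1 = q from rfl, show q + 1 + s - 1 = q + s by omega, ← h1]
    congr 1
    exact Finset.sum_congr rfl fun j _ => by omega

theorem count_identity {n r a e : ℕ} (he : a + e = r * n + n.choose 2) :
    a + e + r.choose 2 = (n + r).choose 2 := by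
  rw [he]
  have h : ((r * n + n.choose 2 + r.choose 2 : ℕ) : ℚ) = ((n + r).choose 2 : ℕ) := by
    push_cast [Nat.cast_choose_two]
    ring
  exact_mod_cast h

theorem degree_identity {n r a e S : ℕ} (hn : 0 < n) (he : a + e = r * n + n.choose 2)
    (hS : S + n.choose 2 = (n - 1) * a) :
    S + e * (n - 1) + r.choose 2 * n = n * (n + r - 1).choose 2 := by
  obtain ⟨u, rfl⟩ : ∃ u, n = u + 1 := ⟨n - 1, by omega⟩
  rw [Nat.add_sub_cancel] at *
  rw [show u + 1 + r - 1 = u + r by omega]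
  have he' : (a : ℚ) + e = r * (u + 1) + (u + 1) * u / 2 := by
    have : ((a + e : ℕ) : ℚ) = ((r * (u + 1) + (u + 1).choose 2 : ℕ) : ℚ) := by rw [he]
    push_cast [Nat.cast_choose_two] at this
    linarith
  have hS' : (S : ℚ) + (u + 1) * u / 2 = u * a := by
    have : ((S + (u + 1).choose 2 : ℕ) : ℚ) = ((u * a : ℕ) : ℚ) := by rw [hS]
    push_cast [Nat.cast_choose_two] at this
    linarith
  have h : ((S + e * u + r.choose 2 * (u + 1) : ℕ) : ℚ) =
      (((u + 1) * (u + r).choose 2 : ℕ) : ℚ) := by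
    push_cast [Nat.cast_choose_two]
    have h1 : (S : ℚ) = u * a - (u + 1) * u / 2 := by linarith
    have h2 : (e : ℚ) = r * (u + 1) + (u + 1) * u / 2 - a := by linarith
    rw [h1, h2]
    ring
  exact_mod_cast h

end Arithmetic

section Existence

variable {K V : Type*} [Field K] [AddCommGroup V] [Module K V]
  (A : CentralArrangement K V)

theorem map_val_eq_sum_singleton {ι α : Type*} (s : Finset ι) (d : ι → α) :
    s.val.map d = ∑ i ∈ s, {d i} := by
  rw [Finset.sum, ← Multiset.sum_map_singleton (s.val.map d), Multiset.map_map]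
  rfl

theorem three_le_card (hV : Module.finrank K V = 3) (hA : A.IsEssential) : 3 ≤ A.card := by
  by_contra! h
  have hbot : Module.finrank K (A.hyperplanes.inf id : Submodule K V) = 0 := by
    rw [show A.hyperplanes.inf id = ⊥ from hA, finrank_bot]
  have hcase : A.hyperplanes.card = 0 ∨ A.hyperplanes.card = 1 ∨ A.hyperplanes.card = 2 := by
    rw [card] at h; omega
  rcases hcase with h | h | h
  · rw [Finset.card_eq_zero.1 h, Finset.inf_empty, finrank_top] at hbot
    omega
  · obtain ⟨H, hH⟩ := Finset.card_eq_one.1 h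
    rw [hH, Finset.inf_singleton, id, A.finrank_hyperplane hV (by simp [hH])] at hbot
    omega
  · obtain ⟨H, H', hne, hH⟩ := Finset.card_eq_two.1 h
    rw [hH, Finset.inf_insert, Finset.inf_singleton, id, id,
      A.finrank_inf_eq_one hV (by simp [hH]) (by simp [hH]) hne] at hbot
    omega

theorem sum_card_localization_sub_one_le (hV : Module.finrank K V = 3) :
    ∑ X ∈ A.lattice₁, ((A.localization X).card - 1) ≤ A.card.choose 2 := by
  rw [← A.sum_choose_two_card_localization hV]
  refine Finset.sum_le_sum fun X _ => ?_
  cases (A.localization X).card with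
  | zero => simp
  | succ q =>
    rw [Nat.choose_succ_succ' q 1, Nat.choose_one_right, Nat.add_sub_cancel]
    omega

theorem finrank_le_finrank_span_add (x : Module.Basis (Fin 3) K (Module.Dual K V)) (m : ℕ) :
    (m + 2).choose m ≤ Module.finrank K (Submodule.span K
      {f : Module.Dual K (homogeneousSubmodule (Fin 3) K m) |
        ∃ h, ∀ u ∈ dvdSubmodule (A.form x h) m, f u = 0}) + (m + 2 - A.card).choose 2 := by
  set G := {f : Module.Dual K (homogeneousSubmodule (Fin 3) K m) |
        ∃ h, ∀ u ∈ dvdSubmodule (A.form x h) m, f u = 0}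
  have h1 := Subspace.finrank_add_finrank_dualCoannihilator_eq (Submodule.span K G)
  rw [finrank_homogeneousSubmodule] at h1
  have h2 : (Submodule.span K G).dualCoannihilator ≤ dvdSubmodule (A.definingPolynomial x) m := by
    intro g hg
    refine A.definingPolynomial_dvd x fun h => ?_
    rw [← mem_dvdSubmodule, ← Subspace.dualAnnihilator_dualCoannihilator_eq
      (W := dvdSubmodule (A.form x h) m), Submodule.mem_dualCoannihilator]
    intro f hf
    rw [Submodule.mem_dualAnnihilator] at hf
    rw [Submodule.mem_dualCoannihilator] at hg
    exact hg f (Submodule.subset_span ⟨h, hf⟩)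
  have h3 := Submodule.finrank_mono h2
  have h4 : Module.finrank K (dvdSubmodule (A.definingPolynomial x) m) ≤
      (m + 2 - A.card).choose 2 := by
    rcases lt_or_ge m A.card with hlt | hge
    · rw [dvdSubmodule_eq_bot (A.definingPolynomial_isHomogeneous x) hlt, finrank_bot]
      exact Nat.zero_le _
    · obtain ⟨e, rfl⟩ := Nat.exists_eq_add_of_le hge
      rw [finrank_dvdSubmodule (A.definingPolynomial_isHomogeneous x)
        (A.definingPolynomial_ne_zero x), finrank_homogeneousSubmodule,
        show A.card + e + 2 - A.card = e + 2 by omega, show e + 3 - 1 = e + 2 by omega,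
        Nat.choose_symm_add]
  have h5 : m + 3 - 1 = m + 2 := by omega
  rw [h5] at h1
  omega

/-- The multiset of `m`-exponents of an essential arrangement in a three-dimensional space. -/
noncomputable def exponents (m : ℕ) : Multiset ℕ :=
  (∑ X ∈ A.lattice₁, (Multiset.range ((A.localization X).card - 1)).map
      fun j => j + A.card - (A.localization X).card)
    + Multiset.replicate
        ((m + 2) * A.card - A.card ^ 2 + A.card.choose 2
          - ∑ X ∈ A.lattice₁, ((A.localization X).card - 1))
        (A.card - 1)
    + Multiset.replicate ((m + 2 - A.card).choose 2) A.card

theorem isExponents_exponents [CharZero K] (hV : Module.finrank K V = 3)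
    (x : Module.Basis (Fin 3) K (Module.Dual K V)) (hA : A.IsEssential) {m : ℕ}
    (hm : A.card ≤ m + 2) : A.IsExponents x m (A.exponents m) := by
  classical
  have hn := A.three_le_card hV hA
  obtain ⟨k, rfl⟩ : ∃ k, m = 1 + k := ⟨m - 1, by omega⟩
  obtain ⟨p, hp⟩ : ∃ p, eval p (A.definingPolynomial x) ≠ 0 := by
    by_contra! h
    exact A.definingPolynomial_ne_zero x (MvPolynomial.funext fun p => by simpa using h p)
  rw [eval_definingPolynomial_ne_zero_iff] at hp
  have hvec : ∀ X : A.lattice₁, ∃ w : V, w ≠ 0 ∧ X.1 = Submodule.span K {w} := by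
    intro X
    have h1 := (A.mem_lattice₁.1 X.2).2
    obtain ⟨w, hw, hw'⟩ := finrank_eq_one_iff'.1 h1
    refine ⟨w, fun h => hw (Subtype.ext h), le_antisymm (fun y hy => ?_) ?_⟩
    · obtain ⟨c, hc⟩ := hw' ⟨y, hy⟩
      exact Submodule.mem_span_singleton.2 ⟨c, congrArg Subtype.val hc⟩
    · exact (Submodule.span_singleton_le_iff_mem _ _).2 w.2
  choose w hw hspan using hvec
  obtain ⟨r, hr⟩ := Nat.exists_eq_add_of_le hm
  set a := ∑ X ∈ A.lattice₁, ((A.localization X).card - 1) with ha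
  set e := (1 + k + 2) * A.card - A.card ^ 2 + A.card.choose 2 - a with he
  have hae : a + e = r * A.card + A.card.choose 2 := by
    have h1 := A.sum_card_localization_sub_one_le hV
    have h2 : (1 + k + 2) * A.card - A.card ^ 2 = r * A.card := by
      rw [hr, add_mul, sq, Nat.add_sub_cancel_left]
    omega
  have hrr : 1 + k + 2 - A.card = r := by omega
  have hcount := count_identity hae
  rw [← hr] at hcount
  have hsymm : (1 + k + 2).choose (1 + k) = (1 + k + 2).choose 2 := Nat.choose_symm_add
  have hι : Fintype.card (Σ X : A.lattice₁, Fin ((A.localization X.1).card - 1)) = a := by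
    rw [Fintype.card_sigma]
    simp only [Fintype.card_fin]
    exact Finset.sum_coe_sort A.lattice₁ fun X => (A.localization X).card - 1
  have hrank := A.finrank_le_finrank_span_add x (1 + k)
  rw [hrr, hsymm] at hrank
  obtain ⟨g, hgG, hg⟩ := exists_linearIndependent_sumElim
    (A.linearIndependent_lineCoeff x hV hm hp hw hspan) _ e
    (by rw [hι]; exact Nat.le_of_add_le_add_right (hcount.le.trans hrank))
  obtain ⟨g', -, hg'⟩ := exists_linearIndependent_sumElim hg Set.univ (r.choose 2) (by
    rw [Submodule.span_univ, finrank_top, Subspace.dual_finrank_eq, finrank_homogeneousSubmodule,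
      Fintype.card_sum, hι, Fintype.card_fin, show 1 + k + 3 - 1 = 1 + k + 2 by omega, hsymm]
    exact hcount.le)
  set d : ((Σ X : A.lattice₁, Fin ((A.localization X.1).card - 1)) ⊕ Fin e) ⊕ Fin (r.choose 2) → ℕ :=
    Sum.elim (Sum.elim (fun t => t.2 + A.card - (A.localization t.1.1).card)
      fun _ => A.card - 1) fun _ => A.card with hd
  have hE : Finset.univ.val.map d = A.exponents (1 + k) := by
    rw [map_val_eq_sum_singleton, Fintype.sum_sum_type, Fintype.sum_sum_type, Fintype.sum_sigma,
      exponents, hrr]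
    simp only [hd, Sum.elim_inl, Sum.elim_inr, Finset.sum_const, Finset.card_univ,
      Fintype.card_fin, Multiset.nsmul_singleton]
    congr 2
    rw [← Finset.sum_coe_sort A.lattice₁]
    refine Finset.sum_congr rfl fun X _ => ?_
    rw [Fin.sum_univ_eq_sum_range
      (fun j => ({j + A.card - (A.localization X.1).card} : Multiset ℕ))]
    exact (map_val_eq_sum_singleton (Finset.range _) _).symm
  rw [← hE]
  refine A.isExponents_of_isRealizable x (p := p) ?_ hg' ?_ ?_
  · rw [Fintype.card_sum, Fintype.card_sum, hι, Fintype.card_fin, Fintype.card_fin, hcount,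
      show 1 + k + 3 - 1 = 1 + k + 2 by omega, hsymm]
  · rintro ((⟨X, j⟩ | i) | i)
    · simp only [hd, Sum.elim_inl]
      rw [Nat.add_sub_assoc (A.card_localization_le X.1)]
      refine A.isRealizable_lineCoeff x _ (A.awayForm_isHomogeneous x X.1)
        (A.eval_awayForm_ne_zero x X.1 hp) fun h => ?_
      rw [A.eval_form_eq_zero_iff x (hspan X) h, or_iff_not_imp_right]
      exact A.form_dvd_awayForm x
    · obtain ⟨h, hh⟩ := hgG i
      refine A.isRealizable_of_form_dvd x (A.cofactor_isHomogeneous x h) ?_ fun h' => ?_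
      · rw [cofactor, map_prod, Finset.prod_ne_zero_iff]
        exact fun h _ => hp h
      · by_cases hne : h' = h
        · subst hne; exact Or.inr hh
        · exact Or.inl (A.form_dvd_cofactor x hne)
    · exact A.isRealizable_of_form_dvd x (A.definingPolynomial_isHomogeneous x)
        ((A.eval_definingPolynomial_ne_zero_iff x).2 hp)
        fun h => Or.inl (Dvd.intro _ (A.form_mul_cofactor x h))
  · have hS : ∑ X ∈ A.lattice₁, ∑ j ∈ Finset.range ((A.localization X).card - 1),
        (j + A.card - (A.localization X).card) + A.card.choose 2 = (A.card - 1) * a := by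
      rw [← A.sum_choose_two_card_localization hV, ← Finset.sum_add_distrib, ha, Finset.mul_sum]
      exact Finset.sum_congr rfl fun X _ => sum_degrees_add_choose_two (A.card_localization_le X)
    have h1 := degree_identity (by omega) hae hS
    rw [show k + 3 - 1 = k + 2 by omega, Nat.choose_symm_add (a := k) (b := 2),
      show k + 2 = A.card + r - 1 by omega, ← h1, Fintype.sum_sum_type, Fintype.sum_sum_type,
      Fintype.sum_sigma]
    simp only [hd, Sum.elim_inl, Sum.elim_inr, Finset.sum_const, Finset.card_univ,
      Fintype.card_fin, smul_eq_mul]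
    congr 2
    rw [← Finset.sum_coe_sort A.lattice₁]
    refine Finset.sum_congr rfl fun X _ => ?_
    exact Fin.sum_univ_eq_sum_range (fun j => j + A.card - (A.localization X.1).card) _

end Existence

section Lattice

variable {K V : Type*} [Field K] [AddCommGroup V] [Module K V] (A : CentralArrangement K V)

theorem top_mem_lattice : ⊤ ∈ A.lattice := A.mem_lattice.2 ⟨∅, by simp, by simp⟩

theorem isMax_lattice_iff (X : {X // X ∈ A.lattice}) : IsMax X ↔ X.1 = ⊤ := by
  constructor
  · intro h
    exact top_le_iff.1 (h (b := ⟨⊤, A.top_mem_lattice⟩) (show X.1 ≤ ⊤ from le_top))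
  · intro h Y _
    change Y.1 ≤ X.1
    rw [h]; exact le_top

theorem eq_top_of_hyperplane_lt (hV : Module.finrank K V = 3) {H Y : Submodule K V}
    (hH : H ∈ A.hyperplanes) (h : H < Y) : Y = ⊤ := by
  have := finiteDimensional_of_finrank_eq_three hV
  have h1 := Submodule.finrank_lt_finrank_of_lt h
  rw [A.finrank_hyperplane hV hH] at h1
  have h2 := Submodule.finrank_le Y
  exact Submodule.eq_top_of_finrank_eq (by omega)

theorem mem_hyperplanes_iff (hV : Module.finrank K V = 3) (X : {X // X ∈ A.lattice}) :
    X.1 ∈ A.hyperplanes ↔ ¬ IsMax X ∧ ∀ Y, X < Y → IsMax Y := by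
  simp only [isMax_lattice_iff]
  constructor
  · intro hX
    refine ⟨fun h => ?_, fun Y hY => A.eq_top_of_hyperplane_lt hV hX hY⟩
    have h1 := A.finrank_hyperplane hV hX
    rw [h, finrank_top] at h1
    omega
  · rintro ⟨hX, hmax⟩
    obtain ⟨B, hB, hBX⟩ := A.mem_lattice.1 X.2
    obtain ⟨H, hH⟩ : B.Nonempty := by
      rw [Finset.nonempty_iff_ne_empty]
      rintro rfl
      exact hX (by rw [← hBX, Finset.inf_empty])
    have hle : X.1 ≤ H := hBX ▸ Finset.inf_le (f := id) hH
    rcases hle.eq_or_lt with h | h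
    · rw [h]; exact hB hH
    · have h1 : H = ⊤ := hmax ⟨H, A.mem_lattice_of_mem_hyperplanes (hB hH)⟩ h
      have h2 := A.finrank_hyperplane hV (hB hH)
      rw [h1, finrank_top] at h2
      omega

theorem isMin_lattice_iff (hA : A.IsEssential) (X : {X // X ∈ A.lattice}) :
    IsMin X ↔ X.1 = ⊥ := by
  have hbot : ⊥ ∈ A.lattice := A.mem_lattice.2 ⟨A.hyperplanes, subset_rfl, hA⟩
  constructor
  · intro h
    exact le_bot_iff.1 (h (b := ⟨⊥, hbot⟩) (show ⊥ ≤ X.1 from bot_le))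
  · intro h Y _
    change X.1 ≤ Y.1
    rw [h]; exact bot_le

theorem finrank_eq_one_iff_lattice (hV : Module.finrank K V = 3) (hA : A.IsEssential)
    (X : {X // X ∈ A.lattice}) :
    Module.finrank K X.1 = 1 ↔ ¬ IsMin X ∧ ∀ Y, Y < X → IsMin Y := by
  have := finiteDimensional_of_finrank_eq_three hV
  simp only [A.isMin_lattice_iff hA]
  constructor
  · intro hX
    refine ⟨fun h => ?_, fun Y hY => ?_⟩
    · rw [h, finrank_bot] at hX
      omega
    · have h1 := Submodule.finrank_lt_finrank_of_lt (show Y.1 < X.1 from hY)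
      exact Submodule.finrank_eq_zero.1 (by omega)
  · rintro ⟨hX, hmin⟩
    obtain ⟨H, hH, hXH⟩ : ∃ H ∈ A.hyperplanes, ¬ X.1 ≤ H := by
      by_contra! h
      exact hX (le_bot_iff.1 ((Finset.le_inf h).trans_eq hA))
    have h1 := A.finrank_inf_hyperplane hV hH hXH
    have h2 : X.1 ⊓ H = ⊥ := hmin
      ⟨_, A.inf_mem_lattice X.2 (A.mem_lattice_of_mem_hyperplanes hH)⟩
      (show X.1 ⊓ H < X.1 from inf_lt_left.2 hXH)
    rw [h2, finrank_bot] at h1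
    omega

variable {K' V' : Type*} [Field K'] [AddCommGroup V'] [Module K' V']
  (A' : CentralArrangement K' V') (hV : Module.finrank K V = 3) (hV' : Module.finrank K' V' = 3)
  (e : {X // X ∈ A.lattice} ≃o {X // X ∈ A'.lattice})

include hV hV' e

theorem apply_mem_hyperplanes_iff (X : {X // X ∈ A.lattice}) :
    (e X).1 ∈ A'.hyperplanes ↔ X.1 ∈ A.hyperplanes := by
  rw [A.mem_hyperplanes_iff hV, A'.mem_hyperplanes_iff hV', e.isMax_apply, e.surjective.forall]
  simp only [e.lt_iff_lt, e.isMax_apply]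

theorem apply_mem_lattice₁_iff (hA : A.IsEssential) (hA' : A'.IsEssential)
    (X : {X // X ∈ A.lattice}) : (e X).1 ∈ A'.lattice₁ ↔ X.1 ∈ A.lattice₁ := by
  rw [mem_lattice₁, mem_lattice₁, and_iff_right (e X).2, and_iff_right X.2,
    A.finrank_eq_one_iff_lattice hV hA, A'.finrank_eq_one_iff_lattice hV' hA', e.isMin_apply,
    e.surjective.forall]
  simp only [e.lt_iff_lt, e.isMin_apply]

theorem card_localization_apply (X : {X // X ∈ A.lattice}) :
    (A'.localization (e X).1).card = (A.localization X.1).card := by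
  symm
  refine Finset.card_bij (fun H hH => (e ⟨H, A.mem_lattice_of_mem_hyperplanes
    (A.mem_localization.1 hH).1⟩).1) (fun H hH => ?_) (fun H hH H' hH' h => ?_) fun H hH => ?_
  · have h1 := A.mem_localization.1 hH
    refine A'.mem_localization.2 ⟨(A.apply_mem_hyperplanes_iff A' hV hV' e _).2 h1.1, ?_⟩
    exact e.monotone h1.2
  · exact congrArg Subtype.val (e.injective (Subtype.ext h))
  · have h1 := A'.mem_localization.1 hH
    obtain ⟨Y, hY⟩ := e.surjective ⟨H, A'.mem_lattice_of_mem_hyperplanes h1.1⟩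
    have hYH : (e Y).1 = H := congrArg Subtype.val hY
    refine ⟨Y.1, A.mem_localization.2 ⟨?_, ?_⟩, hYH⟩
    · rw [← A.apply_mem_hyperplanes_iff A' hV hV' e, hYH]
      exact h1.1
    · refine e.le_iff_le.1 (show (e X).1 ≤ (e Y).1 from ?_)
      rw [hYH]
      exact h1.2

theorem card_eq_of_orderIso : A'.card = A.card := by
  symm
  refine Finset.card_bij (fun H hH => (e ⟨H, A.mem_lattice_of_mem_hyperplanes hH⟩).1)
    (fun H hH => (A.apply_mem_hyperplanes_iff A' hV hV' e _).2 hH)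
    (fun H hH H' hH' h => congrArg Subtype.val (e.injective (Subtype.ext h))) fun H hH => ?_
  obtain ⟨Y, hY⟩ := e.surjective ⟨H, A'.mem_lattice_of_mem_hyperplanes hH⟩
  have hYH : (e Y).1 = H := congrArg Subtype.val hY
  refine ⟨Y.1, ?_, hYH⟩
  rw [← A.apply_mem_hyperplanes_iff A' hV hV' e, hYH]
  exact hH

theorem sum_lattice₁_of_orderIso (hA : A.IsEssential) (hA' : A'.IsEssential) {M : Type*}
    [AddCommMonoid M] (F : ℕ → M) :
    ∑ X ∈ A.lattice₁, F (A.localization X).card = ∑ X ∈ A'.lattice₁, F (A'.localization X).card := by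
  refine Finset.sum_bij (fun X hX => (e ⟨X, (A.mem_lattice₁.1 hX).1⟩).1)
    (fun X hX => (A.apply_mem_lattice₁_iff A' hV hV' e hA hA' _).2 hX)
    (fun X hX X' hX' h => congrArg Subtype.val (e.injective (Subtype.ext h))) (fun X hX => ?_)
    fun X hX => by rw [A.card_localization_apply A' hV hV' e]
  obtain ⟨Y, hY⟩ := e.surjective ⟨X, (A'.mem_lattice₁.1 hX).1⟩
  have hYX : (e Y).1 = X := congrArg Subtype.val hY
  refine ⟨Y.1, ?_, hYX⟩
  rw [← A.apply_mem_lattice₁_iff A' hV hV' e hA hA', hYX]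
  exact hX

theorem exponents_eq_of_orderIso (hA : A.IsEssential) (hA' : A'.IsEssential) (m : ℕ) :
    A.exponents m = A'.exponents m := by
  rw [exponents, exponents, A.card_eq_of_orderIso A' hV hV' e,
    A.sum_lattice₁_of_orderIso A' hV hV' e hA hA' fun c => c - 1,
    A.sum_lattice₁_of_orderIso A' hV hV' e hA hA' fun c =>
      (Multiset.range (c - 1)).map fun j => j + A.card - c]

end Lattice

theorem isExponents_iff {K V : Type*} [Field K] [CharZero K] [AddCommGroup V] [Module K V]
    (hV : Module.finrank K V = 3) (x : Module.Basis (Fin 3) K (Module.Dual K V))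
    (A : CentralArrangement K V) (hA : A.IsEssential) {m : ℕ} (hm : A.card ≤ m + 2)
    (E : Multiset ℕ) : A.IsExponents x m E ↔ E = A.exponents m := by
  have h := A.isExponents_exponents hV x hA hm
  exact ⟨fun hE => IsExponents.unique A x hE h, fun hE => hE ▸ h⟩

end CentralArrangement

/-- For an essential arrangement in a three-dimensional space and `n ≤ m + 2`: it is `m`-free, it
has exactly one multiset of `m`-exponents, the one displayed, and an essential arrangement in a
three-dimensional space (over any field of characteristic zero) with an isomorphic intersection
lattice has the same `m`-exponents. For these arrangements none of the subtractions truncates. -/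
theorem mainTheorem3 {K V : Type*} [Field K] [CharZero K] [AddCommGroup V] [Module K V]
    (hV : Module.finrank K V = 3) (x : Module.Basis (Fin 3) K (Module.Dual K V))
    (A : CentralArrangement K V) (hA : A.IsEssential) (m : ℕ) (hm : A.card ≤ m + 2) :
    A.IsMFree x m ∧
    (∀ E : Multiset ℕ, A.IsExponents x m E ↔
      E = (∑ X ∈ A.lattice₁,
            (Multiset.range ((A.localization X).card - 1)).map
              fun j => j + A.card - (A.localization X).card)
          + Multiset.replicate
              ((m + 2) * A.card - A.card ^ 2 + A.card.choose 2
                - ∑ X ∈ A.lattice₁, ((A.localization X).card - 1))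
              (A.card - 1)
          + Multiset.replicate ((m + 2 - A.card).choose 2) A.card) ∧
    (∀ (K' V' : Type*) [Field K'] [CharZero K'] [AddCommGroup V'] [Module K' V'],
      Module.finrank K' V' = 3 →
      ∀ (x' : Module.Basis (Fin 3) K' (Module.Dual K' V')) (A' : CentralArrangement K' V'),
        A'.IsEssential →
        Nonempty ({X // X ∈ A.lattice} ≃o {X // X ∈ A'.lattice}) →
        ∀ E : Multiset ℕ, A.IsExponents x m E ↔ A'.IsExponents x' m E) := by
  have h := CentralArrangement.isExponents_iff hV x A hA hm
  refine ⟨?_, h, fun K' V' _ _ _ _ hV' x' A' hA' ⟨e⟩ E => ?_⟩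
  · obtain ⟨θ, -, hθ, -⟩ := (h _).2 rfl
    exact ⟨θ, hθ⟩
  · have hcard := A.card_eq_of_orderIso A' hV hV' e
    rw [h E, CentralArrangement.isExponents_iff hV' x' A' hA' (hcard.trans_le hm),
      A.exponents_eq_of_orderIso A' hV hV' e hA hA']
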